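/- Let $H$ be a separable real Hilbert space with norm $\|\cdot\|$ (for instance $\ell_2$ or $\mathbb{R}^d$), let $T\subseteq H$ be closed and totally bounded, let $m\in T$, and let $n\ge 1$ be an integer. Consider empirical risk minimization (ERM) over $T$ in either of the following two problems, which define a random noise vector $w$ and a (measurable) estimator $\hat m$. (a) Mean estimation: $X_1,\dots,X_n$ are i.i.d. random vectors in $H$ with mean $m$, $\hat m\in\operatorname{argmin}_{t\in T}\frac1n\sum_{i=1}^n\|t-X_i\|^2$ almost surely, and $w:=\sqrt n\left(\frac1n\sum_{i=1}^nX_i-m\right)$. (b) Regression: $Y=\sqrt n\,m+w$ is observed for a random vector $w$ in $H$, and $\hat m\in\operatorname{argmin}_{t\in T}\frac1n\|\sqrt n\,t-Y\|^2$ almost surely. Let $\gamma$ be the law of $w$. Assume that $\gamma$ has zero mean and satisfies the log-Sobolev inequality $\mathrm{Ent}(f^2)\le 2\,\mathbb{E}[\|\nabla f(w)\|^2]$ for every continuously differentiable $f\colon H\to\mathbb{R}$ for which $f(w)^2$, $f(w)^2\ln f(w)^2$ and $\|\nabla f(w)\|^2$ are integrable, where $\mathrm{Ent}(g):=\mathbb{E}[g(w)\ln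 g(w)]-\mathbb{E}[g(w)]\ln\mathbb{E}[g(w)]$ (with $0\ln 0=0$). For a probability measure $\mu$ on $H$ let $\mathsf{w}(\mu):=\sup\mathbb{E}[\langle W,Z\rangle]$, the supremum being over all joint laws of $(W,Z)$ with $W\sim\gamma$ and $Z\sim\mu$ for which the expectation exists. Assume that $\mathsf{G}\colon[0,\infty)\to[0,\infty)$ is a width-moment function of $T-T=\{t-s\colon t,s\in T\}$, that is, for all $E\ge0$, $\mathsf{w}(P_Z)\le\mathsf{G}(E)$ for every random vector $Z\in T-T$ with $\mathbb{E}[\|Z\|^2]\le E$. Let $\psi(\lambda):=\ln\mathbb{E}[\exp(\lambda\|m-\hat m\|^2)]$. Then for every $\lambda\ge0$ the expectation defining $\psi(\lambda)$ is finite and $$\psi(\lambda)\le\sup_{\epsilon>0}\left\{-\epsilon+\frac{2\lambda}{\sqrt n}\,\mathsf{G}\!\left(\frac{\epsilon+\psi(\lambda)}{\lambda}\right)+\sqrt{\frac{8\epsilon\lambda(\epsilon+\psi(\lambda))}{n}}\right\},$$ where the supremum may be $+\infty$, and for $\lambda=0$ the term containing $\mathsf{G}$ is read as $0$. -/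

import Mathlib

open MeasureTheory ProbabilityTheory
open scoped RealInnerProductSpace Pointwise

noncomputable section

namespace ERMTail

section Noise

variable {H : Type*} [NormedAddCommGroup H] [InnerProductSpace ℝ H] [MeasurableSpace H]

/-- The entropy functional `Ent(g) = E[g(Y) ln g(Y)] - E[g(Y)] ln E[g(Y)]`, `Y ∼ γ`
(with `0 ln 0 = 0`). -/
def ent (γ : Measure H) (g : H → ℝ) : ℝ :=
  (∫ y, g y * Real.log (g y) ∂γ) - (∫ y, g y ∂γ) * Real.log (∫ y, g y ∂γ)

/-- The log-Sobolev inequality `Ent(f²) ≤ 2 E[‖∇f(Y)‖²]`, `Y ∼ γ`, for all continuously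
differentiable `f`. It is asked only of those `f` for which the three expectations in it are
finite, so that no integral below takes a junk value. -/
def LogSobolev [CompleteSpace H] (γ : Measure H) : Prop :=
  ∀ f : H → ℝ, ContDiff ℝ 1 f →
    Integrable (fun y => f y ^ 2) γ →
    Integrable (fun y => f y ^ 2 * Real.log (f y ^ 2)) γ →
    Integrable (fun y => ‖gradient f y‖ ^ 2) γ →
    ent γ (fun y => f y ^ 2) ≤ 2 * ∫ y, ‖gradient f y‖ ^ 2 ∂γ

/-- `γ` has zero mean. -/
def ZeroMean (γ : Measure H) : Prop :=
  Integrable (fun y => y) γ ∧ ∫ y, y ∂γ = 0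

/-- `π`, a law of `(Y, Z)`, is a coupling of `Y ∼ γ` and `Z ∼ μ`. -/
def IsCoupling (γ μ : Measure H) (π : Measure (H × H)) : Prop :=
  π.map Prod.fst = γ ∧ π.map Prod.snd = μ

/-- The complexity `w(μ) = sup E⟨Y, Z⟩` over all couplings of `Y ∼ γ` and `Z ∼ μ`
(for which the expectation exists), as an extended real number. -/
def width (γ μ : Measure H) : EReal :=
  ⨆ (π : Measure (H × H)) (_ : IsCoupling γ μ π)
    (_ : Integrable (fun p : H × H => ⟪p.1, p.2⟫) π),
    ((∫ p, ⟪p.1, p.2⟫ ∂π : ℝ) : EReal)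

/-- `G : [0, ∞) → [0, ∞)` is a width-moment function of `S` (with respect to `γ`): `w(P_Z) ≤ G(E)`
for every random vector `Z ∈ S` with `E‖Z‖² ≤ E`. Values of `G` at negative arguments play
no role. -/
def IsWidthMoment (γ : Measure H) (S : Set H) (G : ℝ → ℝ) : Prop :=
  ∀ E : ℝ, 0 ≤ E → 0 ≤ G E ∧
    ∀ μ : Measure H, IsProbabilityMeasure μ → (∀ᵐ z ∂μ, z ∈ S) →
      Integrable (fun z => ‖z‖ ^ 2) μ → ∫ z, ‖z‖ ^ 2 ∂μ ≤ E →
      width γ μ ≤ (G E : EReal)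

end Noise

section ERM

variable {Ω : Type*} [MeasurableSpace Ω]
variable {H : Type*} [NormedAddCommGroup H] [InnerProductSpace ℝ H]

/-- `mhat` is (almost surely) a minimizer over `T` of the random empirical risk `Lhat`. -/
def IsERM (P : Measure Ω) (T : Set H) (Lhat : Ω → H → ℝ) (mhat : Ω → H) : Prop :=
  ∀ᵐ ω ∂P, mhat ω ∈ T ∧ IsMinOn (Lhat ω) T (mhat ω)

variable [MeasurableSpace H] [BorelSpace H]

/-- ERM in the mean estimation problem: `X 1, …, X n` are i.i.d. with mean `m`, and `mhat`
minimizes `(1/n) ∑ ‖t - X i‖²` over `t ∈ T`. The associated noise vector is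
`w = √n ((1/n) ∑ X i - m)`. -/
structure IsMeanEstimation (P : Measure Ω) (n : ℕ) (T : Set H) (m : H)
    (X : Fin n → Ω → H) (w mhat : Ω → H) : Prop where
  indep : iIndepFun X P
  identDistrib : ∀ i j, IdentDistrib (X i) (X j) P P
  integrable : ∀ i, Integrable (X i) P
  mean : ∀ i, ∫ ω, X i ω ∂P = m
  noise : ∀ ω, w ω = √(n : ℝ) • ((1 / (n : ℝ)) • (∑ i, X i ω) - m)
  erm : IsERM P T (fun ω t => 1 / (n : ℝ) * ∑ i, ‖t - X i ω‖ ^ 2) mhat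

/-- ERM in the regression problem: the observation is `Y = √n m + w`, and `mhat` minimizes
`(1/n) ‖√n t - Y‖²` over `t ∈ T`. -/
structure IsRegression (P : Measure Ω) (n : ℕ) (T : Set H) (m : H)
    (Y w mhat : Ω → H) : Prop where
  observation : ∀ ω, Y ω = √(n : ℝ) • m + w ω
  erm : IsERM P T (fun ω t => 1 / (n : ℝ) * ‖√(n : ℝ) • t - Y ω‖ ^ 2) mhat

end ERM

end ERMTail

end

/-!
Write `z = mhat - m`. Minimality of `mhat` against the competitor `m` gives, in both problems, the
basic inequality `‖z‖² ≤ (2 / √n) ⟪w, z⟫`. Let `Q` be `P` tilted by `λ ‖z‖²`, and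
`ε = λ E_Q ‖z‖² - ψ(λ)` its relative entropy with respect to `P`, so that
`ψ(λ) = -ε + λ E_Q ‖z‖² ≤ -ε + (2 λ / √n) E_Q ⟪w, z⟫` and `E_Q ‖z‖² = (ε + ψ(λ)) / λ`. It remains to
show `E_Q ⟪w, z⟫ ≤ G (E_Q ‖z‖²) + √(2 ε E_Q ‖z‖²)`. This would follow from the quadratic
transport-entropy inequality for `γ` (Otto–Villani) and a gluing of couplings. The proof here stays
on the dual side, where everything is smooth and finite-dimensional:

* `exists_finite_range_approx` replaces `z` by a variable with finitely many values, without
  increasing its norm, so that its second moment is still admissible in `G`.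
* `exists_integral_softmax_eq`: for finitely many values, minimizing the entropic Kantorovich
  functional yields potentials `v` such that the softmax kernel of `⟪x, z i⟫ - v i` is a coupling of
  `γ` with the law of `z` under `Q`. Its cost is within `log (card ι)` of the dual value
  (`lse_le_sum_softmax_mul`), an error removed by rescaling (`integral_inner_le_of_fintype`).
* `integral_exp_le_of_hamiltonJacobi`: for a smooth subsolution `U` of the Hamilton–Jacobi equation,
  the log-Sobolev inequality makes `t⁻¹ log E exp (t U_t)` nonincreasing in `t`. Applied to the
  log-sum-exp of `⟪x, z i⟫ - v i - t ‖z i‖² / 2` it bounds `E exp (s U_s)` by `exp (s E U_0)`;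
  applied to truncated linear functionals (Herbst) it gives the exponential moments this requires.
* `integral_tilted_le` (the Gibbs variational inequality) transfers that bound from `P` to `Q` at
  the price `ε / s`, and Young's inequality adds `s E_Q ‖z‖² / 2`; optimizing over `s` gives the square
  root.

The supremum in the theorem runs over `ε > 0` while the entropy of `Q` may vanish, and `G` need not
be continuous; the estimate is therefore proved at `ε + η` for every `η > 0`
(`exists_le_of_sq_norm_le`), using that `G` at a larger argument still bounds the width.
-/

noncomputable section

namespace ERMTail

/-! ### The log-Sobolev inequality along subsolutions of a Hamilton–Jacobi equation -/

section HamiltonJacobi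

/-- If `τ L'(τ) ≤ L(τ)` for `τ > 0`, then `L(τ) / τ` is nonincreasing; when `L 0 = 0` its limit at
`0` is `L'(0)`, whence the bound. -/
lemma le_mul_deriv_zero_of_mul_deriv_le {L L' : ℝ → ℝ} (hL : ∀ t, HasDerivAt L (L' t) t)
    (h0 : L 0 = 0) (h : ∀ t, 0 < t → t * L' t ≤ L t) {s : ℝ} (hs : 0 < s) : L s ≤ s * L' 0 := by
  have hder : ∀ t, 0 < t → HasDerivAt (fun t => t⁻¹ * L t)
      (-(t ^ 2)⁻¹ * L t + t⁻¹ * L' t) t := fun t ht =>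
    (hasDerivAt_inv ht.ne').mul (hL t)
  have hanti : AntitoneOn (fun t => t⁻¹ * L t) (Set.Ioi 0) := by
    refine antitoneOn_of_deriv_nonpos (convex_Ioi 0)
      (fun t ht => (hder t ht).continuousAt.continuousWithinAt)
      (fun t ht => ?_) (fun t ht => ?_)
    · rw [interior_Ioi] at ht
      exact (hder t ht).differentiableAt.differentiableWithinAt
    · rw [interior_Ioi] at ht
      have ht : 0 < t := ht
      rw [(hder t ht).deriv]
      have : -(t ^ 2)⁻¹ * L t + t⁻¹ * L' t = (t ^ 2)⁻¹ * (t * L' t - L t) := by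
        field_simp
        ring
      rw [this]
      exact mul_nonpos_of_nonneg_of_nonpos (by positivity) (by linarith [h t ht])
  have hlim : Filter.Tendsto (fun t => t⁻¹ * L t) (nhdsWithin 0 (Set.Ioi 0)) (nhds (L' 0)) := by
    have := (hasDerivAt_iff_tendsto_slope.1 (hL 0)).mono_left
      (nhdsWithin_mono 0 (fun t (ht : 0 < t) => ht.ne'))
    refine this.congr fun t => ?_
    simp [slope_def_field, h0, div_eq_inv_mul]
  have key : s⁻¹ * L s ≤ L' 0 := by
    refine ge_of_tendsto hlim ?_
    filter_upwards [Ioo_mem_nhdsGT hs] with t ht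
    exact hanti ht.1 hs ht.2.le
  rwa [inv_mul_le_iff₀ hs] at key

variable {H : Type*} [NormedAddCommGroup H] [InnerProductSpace ℝ H] [CompleteSpace H]
  [SecondCountableTopology H] [MeasurableSpace H] [BorelSpace H]

/-- The exponential form of the Hopf–Lax argument for the transport-entropy inequality: if `U` is a
smooth subsolution of the Hamilton–Jacobi equation `∂U + ‖∇U‖² / 2 = 0`, the log-Sobolev inequality
applied to `exp (t U_t / 2)` says that `t⁻¹ log E exp (t U_t)` is nonincreasing, and its limit at
`t = 0` is `E U_0`. -/
theorem integral_exp_le_of_hamiltonJacobi {γ : Measure H} [IsProbabilityMeasure γ]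
    (hγ : LogSobolev γ) {U U' : ℝ → H → ℝ} {C : ℝ}
    (hU : ∀ t, ContDiff ℝ 1 (U t)) (hU' : ∀ t x, HasDerivAt (fun r => U r x) (U' t x) t)
    (hcont : ∀ t, Continuous (U' t)) (hC : ∀ t x, |U' t x| ≤ C)
    (hHJ : ∀ t x, U' t x ≤ -(‖gradient (U t) x‖ ^ 2 / 2))
    (hexp : ∀ c, Integrable (fun x => Real.exp (c * |U 0 x|)) γ) {s : ℝ} (hs : 0 < s) :
    Integrable (fun x => Real.exp (s * U s x)) γ ∧
      ∫ x, Real.exp (s * U s x) ∂γ ≤ Real.exp (s * ∫ x, U 0 x ∂γ) := by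
  have hC0 : 0 ≤ C := (abs_nonneg _).trans (hC 0 0)
  have hlip : ∀ t x, |U t x| ≤ |U 0 x| + C * |t| := by
    intro t x
    have := Convex.norm_image_sub_le_of_norm_hasDerivWithin_le (f := fun r => U r x)
      (f' := fun r => U' r x) (C := C) (s := Set.univ) (x := 0) (y := t)
      (fun r _ => (hU' r x).hasDerivWithinAt) (fun r _ => hC r x) convex_univ trivial trivial
    simp only [Real.norm_eq_abs, sub_zero] at this
    linarith [abs_sub_abs_le_abs_sub (U t x) (U 0 x)]
  have hUc : ∀ t, Continuous (U t) := fun t => (hU t).continuous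
  -- The functions below are all dominated by a multiple of some `exp (c |U 0|)`.
  have hdom : ∀ {g : H → ℝ} (c K : ℝ), Continuous g →
      (∀ x, |g x| ≤ K * Real.exp (c * |U 0 x|)) → Integrable g γ := fun c K hg hb =>
    ((hexp c).const_mul K).mono' hg.aestronglyMeasurable (ae_of_all _ hb)
  have hbexp : ∀ (t R : ℝ) x, |t| ≤ R →
      Real.exp (t * U t x) ≤ Real.exp (C * R ^ 2) * Real.exp (R * |U 0 x|) := by
    intro t R x ht
    rw [← Real.exp_add]
    refine Real.exp_le_exp.2 ((le_abs_self _).trans ?_)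
    rw [abs_mul]
    have h0 := abs_nonneg t
    calc |t| * |U t x| ≤ R * (|U 0 x| + C * R) := by
          refine mul_le_mul ht ((hlip t x).trans ?_) (abs_nonneg _) (h0.trans ht)
          have := mul_le_mul_of_nonneg_left ht hC0
          linarith
      _ = _ := by ring
  have hexp_int : ∀ t, Integrable (fun x => Real.exp (t * U t x)) γ := fun t =>
    hdom |t| (Real.exp (C * |t| ^ 2)) (by have := hUc t; fun_prop) fun x => by
      rw [abs_of_pos (Real.exp_pos _)]
      exact hbexp t |t| x le_rfl
  have hbU : ∀ (t R : ℝ) x, |t| ≤ R →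
      |U t x * Real.exp (t * U t x)| ≤
        Real.exp (C * R + C * R ^ 2) * Real.exp ((R + 1) * |U 0 x|) := by
    intro t R x ht
    rw [abs_mul, abs_of_pos (Real.exp_pos _)]
    have h1 : |U t x| ≤ Real.exp (C * R + |U 0 x|) := by
      have := mul_le_mul_of_nonneg_left ht hC0
      linarith [hlip t x, Real.add_one_le_exp (C * R + |U 0 x|)]
    calc _ ≤ Real.exp (C * R + |U 0 x|) * (Real.exp (C * R ^ 2) * Real.exp (R * |U 0 x|)) :=
          mul_le_mul h1 (hbexp t R x ht) (Real.exp_pos _).le (Real.exp_pos _).le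
      _ = _ := by simp only [← Real.exp_add]; congr 1; ring
  have hUexp_int : ∀ t, Integrable (fun x => U t x * Real.exp (t * U t x)) γ := fun t =>
    hdom (|t| + 1) _ (by have := hUc t; fun_prop) fun x => hbU t |t| x le_rfl
  have hU'exp_int : ∀ t, Integrable (fun x => U' t x * Real.exp (t * U t x)) γ := fun t => by
    refine ((hexp_int t).const_mul C).mono'
      (by have := hUc t; have := hcont t; fun_prop) (ae_of_all _ fun x => ?_)
    rw [norm_mul, Real.norm_eq_abs, Real.norm_eq_abs, abs_of_pos (Real.exp_pos _)]
    exact mul_le_mul_of_nonneg_right (hC t x) (Real.exp_pos _).le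
  set F : ℝ → ℝ := fun t => ∫ x, Real.exp (t * U t x) ∂γ with hF
  set D : ℝ → ℝ := fun t => ∫ x, (U t x + t * U' t x) * Real.exp (t * U t x) ∂γ with hD
  have hFD : ∀ t, HasDerivAt F (D t) t := by
    intro t
    have hR : ∀ r ∈ Metric.ball t 1, |r| ≤ |t| + 1 := fun r hr => by
      rw [Metric.mem_ball, Real.dist_eq] at hr
      linarith [abs_sub_abs_le_abs_sub r t]
    set R := |t| + 1 with hRdef
    have hR0 : 0 ≤ R := by positivity
    refine (hasDerivAt_integral_of_dominated_loc_of_deriv_le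
      (F' := fun t x => (U t x + t * U' t x) * Real.exp (t * U t x))
      (bound := fun x => Real.exp (C * R + C * R ^ 2) * Real.exp ((R + 1) * |U 0 x|) +
        R * C * (Real.exp (C * R ^ 2) * Real.exp (R * |U 0 x|)))
      (Metric.ball_mem_nhds t one_pos) ?_ (hexp_int t) ?_ ?_ ?_ ?_).2
    · exact Filter.Eventually.of_forall fun r => (hexp_int r).aestronglyMeasurable
    · have := hUc t
      have := hcont t
      fun_prop
    · refine ae_of_all _ fun x r hr => ?_
      have h1 := hbU r R x (hR r hr)
      have h2 : |r * U' r x * Real.exp (r * U r x)| ≤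
          R * C * (Real.exp (C * R ^ 2) * Real.exp (R * |U 0 x|)) := by
        rw [abs_mul, abs_mul, abs_of_pos (Real.exp_pos _)]
        exact mul_le_mul (mul_le_mul (hR r hr) (hC r x) (abs_nonneg _) hR0)
          (hbexp r R x (hR r hr)) (Real.exp_pos _).le (by positivity)
      rw [add_mul, Real.norm_eq_abs]
      exact (abs_add_le _ _).trans (add_le_add h1 h2)
    · exact ((hexp _).const_mul _).add (((hexp _).const_mul _).const_mul _)
    · refine ae_of_all _ fun x r _ => ?_
      have := ((hasDerivAt_id r).mul (hU' r x)).exp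
      refine this.congr_deriv ?_
      simp only [id_eq, Pi.mul_apply]
      ring
  have hFpos : ∀ t, 0 < F t := fun t => integral_exp_pos (hexp_int t)
  have hLSI : ∀ t, 0 < t → t * (D t / F t) ≤ Real.log (F t) := by
    intro t ht
    set f : H → ℝ := fun x => Real.exp (t / 2 * U t x) with hf
    have hfsq : ∀ x, f x ^ 2 = Real.exp (t * U t x) := fun x => by
      simp only [hf, ← Real.exp_nat_mul]
      congr 1
      push_cast
      ring
    have hgrad : ∀ x, gradient f x = (t / 2 * f x) • gradient (U t) x := by
      intro x
      have h1 : HasGradientAt (U t) (gradient (U t) x) x :=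
        ((hU t).differentiable one_ne_zero x).hasGradientAt
      refine HasGradientAt.gradient ?_
      rw [hasGradientAt_iff_hasFDerivAt] at h1 ⊢
      have h2 := (h1.const_mul (t / 2)).exp
      refine h2.congr_fderiv ?_
      rw [map_smulₛₗ, smul_smul, mul_comm]
      rfl
    have hgradsq : ∀ x, ‖gradient f x‖ ^ 2 =
        t ^ 2 / 4 * (‖gradient (U t) x‖ ^ 2 * Real.exp (t * U t x)) := fun x => by
      rw [hgrad, norm_smul, mul_pow, Real.norm_eq_abs, sq_abs, mul_pow, hfsq]
      ring
    have hgc : Continuous (gradient (U t)) := by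
      have : Continuous (fun x => fderiv ℝ (U t) x) := (hU t).continuous_fderiv one_ne_zero
      exact (InnerProductSpace.toDual ℝ H).symm.continuous.comp this
    have hgint : Integrable (fun x => ‖gradient (U t) x‖ ^ 2 * Real.exp (t * U t x)) γ := by
      refine ((hexp_int t).const_mul (2 * C)).mono'
        (by have := hUc t; fun_prop) (ae_of_all _ fun x => ?_)
      rw [Real.norm_eq_abs, abs_of_nonneg (by positivity)]
      refine mul_le_mul_of_nonneg_right ?_ (Real.exp_pos _).le
      linarith [hHJ t x, (abs_le.1 (hC t x)).1]
    have hmain := hγ f ((contDiff_const.mul (hU t)).exp)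
      (by simpa only [hfsq] using hexp_int t)
      (by simpa only [hfsq, Real.log_exp, mul_comm, mul_left_comm, mul_assoc] using
        (hUexp_int t).const_mul t)
      (by simpa only [hgradsq] using hgint.const_mul (t ^ 2 / 4))
    simp only [ent, hfsq, hgradsq, Real.log_exp] at hmain
    rw [integral_const_mul] at hmain
    have e1 : ∫ x, Real.exp (t * U t x) * (t * U t x) ∂γ =
        t * ∫ x, U t x * Real.exp (t * U t x) ∂γ := by
      rw [← integral_const_mul]
      refine integral_congr_ae (ae_of_all _ fun x => ?_)
      ring
    have e2 : D t = (∫ x, U t x * Real.exp (t * U t x) ∂γ) +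
        t * ∫ x, U' t x * Real.exp (t * U t x) ∂γ := by
      rw [← integral_const_mul, ← integral_add (hUexp_int t) ((hU'exp_int t).const_mul t)]
      refine integral_congr_ae (ae_of_all _ fun x => ?_)
      ring
    have e3 : (∫ x, ‖gradient (U t) x‖ ^ 2 * Real.exp (t * U t x) ∂γ) ≤
        -2 * ∫ x, U' t x * Real.exp (t * U t x) ∂γ := by
      rw [← integral_const_mul]
      refine integral_mono hgint ((hU'exp_int t).const_mul _) fun x => ?_
      have := mul_le_mul_of_nonneg_right (hHJ t x) (Real.exp_pos (t * U t x)).le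
      linarith
    rw [e1] at hmain
    rw [← mul_div_assoc, div_le_iff₀ (hFpos t), e2]
    have := mul_le_mul_of_nonneg_left e3 (sq_nonneg t)
    change _ - F t * Real.log (F t) ≤ _ at hmain
    linarith
  refine ⟨hexp_int s, ?_⟩
  have hF0 : F 0 = 1 := by simp [hF]
  have := le_mul_deriv_zero_of_mul_deriv_le (L := fun t => Real.log (F t))
    (fun t => (hFD t).log (hFpos t).ne') (by simp [hF0]) hLSI hs
  rw [hF0, Real.log_le_iff_le_exp (hFpos s)] at this
  simpa [hF, hD] using this

end HamiltonJacobi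

/-! ### Log-sum-exp and softmax -/

section LogSumExp

variable {ι : Type*} [Fintype ι]

/-- The log-sum-exp function `log ∑ exp (a i)`, a smooth substitute for the maximum. -/
def lse (a : ι → ℝ) : ℝ := Real.log (∑ i, Real.exp (a i))

/-- The softmax weights `exp (a i) / ∑ exp (a j)`, the gradient of `lse`. -/
def softmax (a : ι → ℝ) (i : ι) : ℝ := Real.exp (a i) / ∑ j, Real.exp (a j)

variable [Nonempty ι]

lemma sum_exp_pos (a : ι → ℝ) : 0 < ∑ i, Real.exp (a i) :=
  Finset.sum_pos (fun _ _ => Real.exp_pos _) Finset.univ_nonempty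

lemma softmax_pos (a : ι → ℝ) (i : ι) : 0 < softmax a i :=
  div_pos (Real.exp_pos _) (sum_exp_pos a)

lemma sum_softmax (a : ι → ℝ) : ∑ i, softmax a i = 1 := by
  simp only [softmax, ← Finset.sum_div]
  exact div_self (sum_exp_pos a).ne'

lemma softmax_le_one (a : ι → ℝ) (i : ι) : softmax a i ≤ 1 :=
  (sum_softmax a) ▸ Finset.single_le_sum (f := softmax a) (fun j _ => (softmax_pos a j).le)
    (Finset.mem_univ i)

lemma exp_lse (a : ι → ℝ) : Real.exp (lse a) = ∑ i, Real.exp (a i) :=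
  Real.exp_log (sum_exp_pos a)

lemma log_softmax (a : ι → ℝ) (i : ι) : Real.log (softmax a i) = a i - lse a := by
  rw [softmax, Real.log_div (Real.exp_pos _).ne' (sum_exp_pos a).ne', Real.log_exp, lse]

lemma le_lse (a : ι → ℝ) (i : ι) : a i ≤ lse a := by
  rw [← Real.exp_le_exp, exp_lse]
  exact Finset.single_le_sum (f := fun j => Real.exp (a j)) (fun j _ => (Real.exp_pos _).le)
    (Finset.mem_univ i)

lemma lse_mono {a b : ι → ℝ} (h : ∀ i, a i ≤ b i) : lse a ≤ lse b :=
  Real.log_le_log (sum_exp_pos a) (Finset.sum_le_sum fun i _ => Real.exp_le_exp.2 (h i))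

lemma lse_add_const (a : ι → ℝ) (c : ℝ) : lse (fun i => a i + c) = lse a + c := by
  rw [lse, lse]
  simp only [Real.exp_add, ← Finset.sum_mul]
  rw [Real.log_mul (sum_exp_pos a).ne' (Real.exp_pos c).ne', Real.log_exp]

lemma exists_abs_lse_le (a : ι → ℝ) : ∃ i, |lse a| ≤ |a i| + Real.log (Fintype.card ι) := by
  obtain ⟨i, hi⟩ := Finite.exists_max fun i => |a i|
  refine ⟨i, abs_le.2 ⟨?_, ?_⟩⟩
  · have h0 : 0 ≤ Real.log (Fintype.card ι) := Real.log_natCast_nonneg _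
    linarith [le_lse a i, neg_abs_le (a i)]
  · have : lse a ≤ lse (fun _ : ι => |a i|) := lse_mono fun j => (le_abs_self _).trans (hi j)
    refine this.trans_eq ?_
    simp only [lse, Finset.sum_const, Finset.card_univ, nsmul_eq_mul]
    rw [Real.log_mul (by exact_mod_cast Fintype.card_ne_zero) (Real.exp_pos _).ne', Real.log_exp,
      add_comm]

/-- The softmax average of `a` falls short of `lse a` by the entropy of the softmax weights, which
is at most `log (card ι)`. -/
lemma lse_le_sum_softmax_mul (a : ι → ℝ) :
    lse a ≤ ∑ i, softmax a i * a i + Real.log (Fintype.card ι) := by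
  have hk : (0 : ℝ) < Fintype.card ι := by exact_mod_cast Fintype.card_pos
  have key : ∀ i, softmax a i * (lse a - a i - Real.log (Fintype.card ι)) ≤
      (Fintype.card ι : ℝ)⁻¹ - softmax a i := by
    intro i
    have hq := softmax_pos a i
    have h1 := Real.log_le_sub_one_of_pos (inv_pos.2 (mul_pos hk hq))
    rw [Real.log_inv, Real.log_mul hk.ne' hq.ne', log_softmax] at h1
    have h2 := mul_le_mul_of_nonneg_left h1 hq.le
    calc _ = softmax a i * -(Real.log (Fintype.card ι) + (a i - lse a)) := by ring
      _ ≤ _ := h2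
      _ = _ := by field_simp
  have := Finset.sum_le_sum fun i (_ : i ∈ Finset.univ) => key i
  simp only [mul_sub, Finset.sum_sub_distrib, ← Finset.sum_mul, sum_softmax, Finset.sum_const,
    Finset.card_univ, nsmul_eq_mul, mul_inv_cancel₀ hk.ne'] at this
  linarith

lemma lse_add_le (a h : ι → ℝ) :
    lse (fun i => a i + h i) ≤ lse a + ∑ i, softmax a i * (Real.exp (h i) - 1) := by
  have h1 : ∑ i, Real.exp (a i + h i) =
      (∑ i, Real.exp (a i)) * ∑ i, softmax a i * Real.exp (h i) := by
    rw [Finset.mul_sum]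
    refine Finset.sum_congr rfl fun i _ => ?_
    have := (sum_exp_pos a).ne'
    rw [softmax, Real.exp_add]
    field_simp
  have hpos : 0 < ∑ i, softmax a i * Real.exp (h i) :=
    Finset.sum_pos (fun i _ => mul_pos (softmax_pos a i) (Real.exp_pos _)) Finset.univ_nonempty
  rw [lse, h1, Real.log_mul (sum_exp_pos a).ne' hpos.ne']
  have := Real.log_le_sub_one_of_pos hpos
  simp only [mul_sub, mul_one, Finset.sum_sub_distrib, sum_softmax]
  rw [lse]
  linarith

lemma contDiff_lse {k : WithTop ℕ∞} : ContDiff ℝ k (lse : (ι → ℝ) → ℝ) :=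
  ContDiff.log (ContDiff.sum fun i _ => (contDiff_apply ℝ ℝ i).exp) fun a => (sum_exp_pos a).ne'

lemma hasFDerivAt_lse (a : ι → ℝ) :
    HasFDerivAt lse (∑ i, softmax a i • ContinuousLinearMap.proj (R := ℝ) (φ := fun _ : ι => ℝ) i)
      a := by
  have h : HasFDerivAt (fun a : ι → ℝ => ∑ i, Real.exp (a i))
      (∑ i, Real.exp (a i) • ContinuousLinearMap.proj (R := ℝ) (φ := fun _ : ι => ℝ) i) a :=
    HasFDerivAt.fun_sum fun i _ => (hasFDerivAt_apply i a).exp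
  refine (h.log (sum_exp_pos a).ne').congr_fderiv ?_
  simp only [Finset.smul_sum, smul_smul, softmax, div_eq_inv_mul]

lemma continuous_softmax (i : ι) : Continuous (fun a : ι → ℝ => softmax a i) := by
  unfold softmax
  exact Continuous.div (by fun_prop) (by fun_prop) fun a => (sum_exp_pos a).ne'

end LogSumExp

/-! ### Exponential moments under the log-Sobolev inequality -/

section ExpMoments

lemma hasFDerivAt_inner_right {H : Type*} [NormedAddCommGroup H] [InnerProductSpace ℝ H]
    [CompleteSpace H] (z x : H) :
    HasFDerivAt (fun x : H => ⟪x, z⟫) (InnerProductSpace.toDual ℝ H z : H →L[ℝ] ℝ) x := by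
  refine (InnerProductSpace.toDual ℝ H z).hasFDerivAt.congr_of_eventuallyEq
    (Filter.Eventually.of_forall fun y => ?_)
  exact real_inner_comm z y

lemma norm_sum_smul_sq_le {ι H : Type*} [Fintype ι] [NormedAddCommGroup H]
    [InnerProductSpace ℝ H] {q : ι → ℝ} (hq : ∀ i, 0 ≤ q i) (hq1 : ∑ i, q i = 1) (z : ι → H) :
    ‖∑ i, q i • z i‖ ^ 2 ≤ ∑ i, q i * ‖z i‖ ^ 2 := by
  have : ConvexOn ℝ Set.univ fun x : H => ‖x‖ ^ 2 :=
    (convexOn_univ_norm).pow (fun _ _ => norm_nonneg _) 2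
  exact this.map_sum_le (fun i _ => hq i) hq1 fun i _ => trivial

variable {H : Type*} [NormedAddCommGroup H] [InnerProductSpace ℝ H] [CompleteSpace H]
  [SecondCountableTopology H] [MeasurableSpace H] [BorelSpace H]

lemma abs_arctan_le (x : ℝ) : |Real.arctan x| ≤ |x| := by
  have := Convex.norm_image_sub_le_of_norm_hasDerivWithin_le (f := Real.arctan)
      (f' := fun r => 1 / (1 + r ^ 2)) (C := 1) (s := Set.univ) (x := 0) (y := x)
      (fun r _ => (Real.hasDerivAt_arctan r).hasDerivWithinAt) (fun r _ => ?_)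
      convex_univ trivial trivial
  · simpa using this
  · rw [Real.norm_eq_abs, abs_of_nonneg (by positivity)]
    exact div_le_one_of_le₀ (by nlinarith) (by positivity)

/-- Herbst's argument, for the bounded truncations `arctan (r ⟪x, z⟫) / r` of a linear
functional. -/
lemma integral_exp_arctan_le {γ : Measure H} [IsProbabilityMeasure γ] (hγ : LogSobolev γ)
    (hint : Integrable (fun x => x) γ) (z : H) {r : ℝ} (hr : 0 < r) :
    Integrable (fun x => Real.exp (r⁻¹ * Real.arctan (r * ⟪x, z⟫))) γ ∧
    ∫ x, Real.exp (r⁻¹ * Real.arctan (r * ⟪x, z⟫)) ∂γ ≤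
      Real.exp ((∫ x, ‖x‖ * ‖z‖ ∂γ) + ‖z‖ ^ 2 / 2) := by
  have hcd : ContDiff ℝ 1 (fun x : H => r⁻¹ * Real.arctan (r * ⟪x, z⟫)) :=
    contDiff_const.mul (contDiff_const.mul (contDiff_id.inner ℝ contDiff_const)).arctan
  have hgrad : ∀ t x, gradient (fun x : H => r⁻¹ * Real.arctan (r * ⟪x, z⟫) - t * (‖z‖ ^ 2 / 2)) x
      = (1 / (1 + (r * ⟪x, z⟫) ^ 2)) • z := by
    intro t x
    refine HasGradientAt.gradient ?_
    rw [hasGradientAt_iff_hasFDerivAt]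
    have h1 := ((hasFDerivAt_inner_right z x).const_mul r).arctan
    refine ((h1.const_mul r⁻¹).sub_const _).congr_fderiv ?_
    rw [map_smulₛₗ, smul_smul, smul_smul]
    congr 1
    simp only [conj_trivial]
    field_simp
  have habs : ∀ x : H, |r⁻¹ * Real.arctan (r * ⟪x, z⟫)| ≤ ‖x‖ * ‖z‖ := fun x => by
    rw [abs_mul, abs_of_pos (inv_pos.2 hr), inv_mul_le_iff₀ hr]
    refine (abs_arctan_le _).trans ?_
    rw [abs_mul, abs_of_pos hr]
    exact mul_le_mul_of_nonneg_left (abs_real_inner_le_norm x z) hr.le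
  have hbdd : ∀ x : H, |r⁻¹ * Real.arctan (r * ⟪x, z⟫)| ≤ r⁻¹ * (Real.pi / 2) := fun x => by
    rw [abs_mul, abs_of_pos (inv_pos.2 hr)]
    exact mul_le_mul_of_nonneg_left (abs_le.2 ⟨(Real.neg_pi_div_two_lt_arctan _).le,
      (Real.arctan_lt_pi_div_two _).le⟩) (inv_pos.2 hr).le
  have hmain := integral_exp_le_of_hamiltonJacobi hγ
    (U := fun t x => r⁻¹ * Real.arctan (r * ⟪x, z⟫) - t * (‖z‖ ^ 2 / 2))
    (U' := fun _ _ => -(‖z‖ ^ 2 / 2)) (C := ‖z‖ ^ 2 / 2)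
    (fun t => hcd.sub contDiff_const)
    (fun t x => by simpa using ((hasDerivAt_id t).mul_const (‖z‖ ^ 2 / 2)).const_sub _)
    (fun t => continuous_const)
    (fun t x => by rw [abs_neg, abs_of_nonneg (by positivity)])
    (fun t x => by
      rw [hgrad, norm_smul, neg_le_neg_iff]
      have : ‖1 / (1 + (r * ⟪x, z⟫) ^ 2)‖ ≤ 1 := by
        rw [Real.norm_eq_abs, abs_of_nonneg (by positivity)]
        exact div_le_one_of_le₀ (by nlinarith [sq_nonneg (r * ⟪x, z⟫)]) (by positivity)
      have := mul_le_mul_of_nonneg_right this (norm_nonneg z)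
      have := pow_le_pow_left₀ (by positivity) this 2
      linarith)
    (fun c => by
      refine (integrable_const (Real.exp (|c| * (r⁻¹ * (Real.pi / 2))))).mono'
        (by have := hcd.continuous; fun_prop) (ae_of_all _ fun x => ?_)
      rw [Real.norm_eq_abs, Real.abs_exp, Real.exp_le_exp, zero_mul, sub_zero]
      exact mul_le_mul (le_abs_self c) (hbdd x) (abs_nonneg _) (abs_nonneg _))
    (s := 1) one_pos
  simp only [one_mul, zero_mul, sub_zero] at hmain
  have hsplit : ∀ x : H, Real.exp (r⁻¹ * Real.arctan (r * ⟪x, z⟫)) =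
      Real.exp (‖z‖ ^ 2 / 2) * Real.exp (r⁻¹ * Real.arctan (r * ⟪x, z⟫) - ‖z‖ ^ 2 / 2) :=
    fun x => by rw [← Real.exp_add]; congr 1; ring
  simp only [hsplit]
  refine ⟨hmain.1.const_mul _, ?_⟩
  rw [integral_const_mul, add_comm, Real.exp_add]
  refine mul_le_mul_of_nonneg_left (hmain.2.trans (Real.exp_le_exp.2 ?_)) (Real.exp_pos _).le
  refine integral_mono ?_ (hint.norm.mul_const _) fun x => (le_abs_self _).trans (habs x)
  exact (hint.norm.mul_const ‖z‖).mono' hcd.continuous.aestronglyMeasurable (ae_of_all _ habs)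

theorem integrable_exp_inner {γ : Measure H} [IsProbabilityMeasure γ] (hγ : LogSobolev γ)
    (hint : Integrable (fun x => x) γ) (z : H) : Integrable (fun x => Real.exp ⟪x, z⟫) γ := by
  set f : ℕ → H → ℝ := fun k x =>
    Real.exp (((k : ℝ) + 1) * Real.arctan (((k : ℝ) + 1)⁻¹ * ⟪x, z⟫)) with hf
  have hfi : ∀ k, Integrable (f k) γ ∧
      ∫ x, f k x ∂γ ≤ Real.exp ((∫ x, ‖x‖ * ‖z‖ ∂γ) + ‖z‖ ^ 2 / 2) := fun k => by
    have := integral_exp_arctan_le hγ hint z (r := ((k : ℝ) + 1)⁻¹) (by positivity)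
    simpa only [inv_inv] using this
  have hlim : ∀ x, Filter.Tendsto (fun k => f k x) Filter.atTop (nhds (Real.exp ⟪x, z⟫)) := by
    intro x
    refine (Real.continuous_exp.tendsto _).comp ?_
    have hd : HasDerivAt (fun t : ℝ => Real.arctan (t * ⟪x, z⟫)) ⟪x, z⟫ 0 := by
      have := ((hasDerivAt_id (0 : ℝ)).mul_const ⟪x, z⟫).arctan
      simpa using this
    have ht : Filter.Tendsto (fun k : ℕ => ((k : ℝ) + 1)⁻¹) Filter.atTop
        (nhdsWithin 0 {0}ᶜ) := by
      refine tendsto_nhdsWithin_iff.2 ⟨?_, Filter.Eventually.of_forall fun k => ?_⟩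
      · simpa only [one_div] using tendsto_one_div_add_atTop_nhds_zero_nat (𝕜 := ℝ)
      · have : ((k : ℝ) + 1)⁻¹ ≠ 0 := by positivity
        exact this
    refine ((hasDerivAt_iff_tendsto_slope.1 hd).comp ht).congr fun k => ?_
    simp [slope_def_field, div_eq_inv_mul]
  refine ⟨by fun_prop, ?_⟩
  have hfatou : ∫⁻ x, ‖Real.exp ⟪x, z⟫‖ₑ ∂γ ≤
      Filter.liminf (fun k => ∫⁻ x, ‖f k x‖ₑ ∂γ) Filter.atTop := by
    refine le_trans (le_of_eq ?_)
      (lintegral_liminf_le' fun k => (hfi k).1.aestronglyMeasurable.enorm)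
    refine lintegral_congr fun x => ?_
    exact (((continuous_enorm.tendsto _).comp (hlim x)).liminf_eq).symm
  refine hfatou.trans_lt (lt_of_le_of_lt ?_ (ENNReal.ofReal_lt_top
    (r := Real.exp ((∫ x, ‖x‖ * ‖z‖ ∂γ) + ‖z‖ ^ 2 / 2))))
  refine Filter.liminf_le_of_le (by isBoundedDefault) fun b hb => ?_
  obtain ⟨k, hk⟩ := hb.exists
  refine hk.trans ?_
  rw [← ofReal_integral_norm_eq_lintegral_enorm (hfi k).1]
  refine ENNReal.ofReal_le_ofReal (le_trans (le_of_eq ?_) (hfi k).2)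
  exact integral_congr_ae (ae_of_all _ fun x => by simp [hf])

lemma integrable_exp_abs_inner {γ : Measure H} [IsProbabilityMeasure γ] (hγ : LogSobolev γ)
    (hint : Integrable (fun x => x) γ) (z : H) (c : ℝ) :
    Integrable (fun x => Real.exp (c * |⟪x, z⟫|)) γ := by
  refine ((integrable_exp_inner hγ hint (c • z)).add
    (integrable_exp_inner hγ hint ((-c) • z))).mono' (by fun_prop) (ae_of_all _ fun x => ?_)
  simp only [Real.norm_eq_abs, Real.abs_exp, Pi.add_apply, inner_smul_right]
  rcases abs_cases ⟪x, z⟫ with h | h <;> rw [h.1]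
  · linarith [Real.exp_pos (-c * ⟪x, z⟫)]
  · rw [mul_neg, neg_mul]
    linarith [Real.exp_pos (c * ⟪x, z⟫)]

variable {ι : Type*} [Fintype ι] [Nonempty ι]

lemma integrable_exp_abs_lse {γ : Measure H} [IsProbabilityMeasure γ] (hγ : LogSobolev γ)
    (hint : Integrable (fun x => x) γ) (z : ι → H) (v : ι → ℝ) (c : ℝ) :
    Integrable (fun x => Real.exp (c * |lse fun i => ⟪x, z i⟫ - v i|)) γ := by
  have hcont : Continuous fun x : H => lse fun i => ⟪x, z i⟫ - v i :=
    (contDiff_lse (k := 0)).continuous.comp (by fun_prop)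
  refine (integrable_finsetSum Finset.univ fun i _ =>
    ((integrable_exp_abs_inner hγ hint (z i) |c|).const_mul
      (Real.exp (|c| * (|v i| + Real.log (Fintype.card ι)))))).mono'
    ((hcont.abs.const_mul c).rexp.aestronglyMeasurable) (ae_of_all _ fun x => ?_)
  obtain ⟨i, hi⟩ := exists_abs_lse_le fun i => ⟪x, z i⟫ - v i
  refine le_trans ?_ (Finset.single_le_sum (f := fun i =>
    Real.exp (|c| * (|v i| + Real.log (Fintype.card ι))) * Real.exp (|c| * |⟪x, z i⟫|))
    (fun j _ => by positivity) (Finset.mem_univ i))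
  rw [Real.norm_eq_abs, Real.abs_exp, ← Real.exp_add, Real.exp_le_exp, ← mul_add]
  refine mul_le_mul (le_abs_self c) (hi.trans ?_) (abs_nonneg _) (abs_nonneg _)
  linarith [abs_sub ⟪x, z i⟫ (v i)]

/-- The functions `U_t (x) = lse (⟪x, z i⟫ - v i - t ‖z i‖² / 2)` are a smooth subsolution of the
Hamilton–Jacobi equation: `∇U_t` and `∂U_t` are softmax averages of `z i` and `-‖z i‖² / 2`. -/
theorem integral_exp_lse_le {γ : Measure H} [IsProbabilityMeasure γ] (hγ : LogSobolev γ)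
    (hint : Integrable (fun x => x) γ) (z : ι → H) (v : ι → ℝ) {s : ℝ} (hs : 0 < s) :
    Integrable (fun x => Real.exp (s * lse fun i => ⟪x, z i⟫ - v i - s * (‖z i‖ ^ 2 / 2))) γ ∧
    ∫ x, Real.exp (s * lse fun i => ⟪x, z i⟫ - v i - s * (‖z i‖ ^ 2 / 2)) ∂γ ≤
      Real.exp (s * ∫ x, lse (fun i => ⟪x, z i⟫ - v i) ∂γ) := by
  set a : ℝ → H → ι → ℝ := fun t x i => ⟪x, z i⟫ - v i - t * (‖z i‖ ^ 2 / 2) with ha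
  have hgrad : ∀ t x, gradient (fun x => lse (a t x)) x = ∑ i, softmax (a t x) i • z i := by
    intro t x
    refine HasGradientAt.gradient ?_
    rw [hasGradientAt_iff_hasFDerivAt]
    have h1 : HasFDerivAt (a t)
        (ContinuousLinearMap.pi fun i => (InnerProductSpace.toDual ℝ H (z i) : H →L[ℝ] ℝ)) x := by
      rw [hasFDerivAt_pi]
      intro i
      exact ((hasFDerivAt_inner_right (z i) x).sub_const _).sub_const _
    refine ((hasFDerivAt_lse (a t x)).comp x h1).congr_fderiv ?_
    ext y
    simp
  have hsum : ∀ i, ‖z i‖ ^ 2 / 2 ≤ ∑ j, ‖z j‖ ^ 2 / 2 := fun i =>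
    Finset.single_le_sum (f := fun j => ‖z j‖ ^ 2 / 2) (fun j _ => by positivity)
      (Finset.mem_univ i)
  have := integral_exp_le_of_hamiltonJacobi hγ (U := fun t x => lse (a t x))
    (U' := fun t x => ∑ i, softmax (a t x) i * -(‖z i‖ ^ 2 / 2)) (C := ∑ i, ‖z i‖ ^ 2 / 2)
    (fun t => contDiff_lse.comp (contDiff_pi.2 fun i =>
      ((contDiff_id.inner ℝ contDiff_const).sub contDiff_const).sub contDiff_const))
    (fun t x => ?_) (fun t => ?_) (fun t x => ?_) (fun t x => ?_) (fun c => ?_) hs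
  · simpa only [ha, zero_mul, sub_zero] using this
  · have h1 : HasDerivAt (fun r => a r x) (fun i => -(‖z i‖ ^ 2 / 2)) t := by
      rw [hasDerivAt_pi]
      intro i
      simpa using ((hasDerivAt_id t).mul_const (‖z i‖ ^ 2 / 2)).const_sub (⟪x, z i⟫ - v i)
    refine ((hasFDerivAt_lse (a t x)).comp_hasDerivAt t h1).congr_deriv ?_
    simp
  · refine continuous_finsetSum _ fun i _ => Continuous.mul
      ((continuous_softmax i).comp (by fun_prop)) continuous_const
  · simp only [mul_neg, Finset.sum_neg_distrib, abs_neg]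
    rw [abs_of_nonneg (Finset.sum_nonneg fun i _ =>
      mul_nonneg (softmax_pos _ i).le (by positivity))]
    exact Finset.sum_le_sum fun i _ =>
      mul_le_of_le_one_left (by positivity) (softmax_le_one _ i)
  · simp only [hgrad, mul_neg, Finset.sum_neg_distrib, neg_le_neg_iff]
    have := norm_sum_smul_sq_le (fun i => (softmax_pos (a t x) i).le) (sum_softmax _) z
    simp only [← mul_div_assoc, ← Finset.sum_div]
    linarith
  · simpa only [ha, zero_mul, sub_zero] using integrable_exp_abs_lse hγ hint z v c

end ExpMoments

/-! ### Semi-discrete entropic optimal transport -/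

section Potentials

variable {H : Type*} [NormedAddCommGroup H] [InnerProductSpace ℝ H]
  {ι : Type*} [Fintype ι] [Nonempty ι]

lemma continuous_lse_inner (z : ι → H) (v : ι → ℝ) :
    Continuous fun x : H => lse fun i => ⟪x, z i⟫ - v i :=
  (contDiff_lse (k := 0)).continuous.comp (by fun_prop)

lemma abs_lse_inner_le (z : ι → H) (v : ι → ℝ) (x : H) :
    |lse fun i => ⟪x, z i⟫ - v i| ≤
      ‖x‖ * (∑ i, ‖z i‖) + ((∑ i, |v i|) + Real.log (Fintype.card ι)) := by
  obtain ⟨i, hi⟩ := exists_abs_lse_le fun i => ⟪x, z i⟫ - v i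
  have h1 : ‖z i‖ ≤ ∑ i, ‖z i‖ :=
    Finset.single_le_sum (f := fun i => ‖z i‖) (fun j _ => norm_nonneg _) (Finset.mem_univ i)
  have h2 : |v i| ≤ ∑ i, |v i| :=
    Finset.single_le_sum (f := fun i => |v i|) (fun j _ => abs_nonneg _) (Finset.mem_univ i)
  have h3 := mul_le_mul_of_nonneg_left h1 (norm_nonneg x)
  linarith [abs_sub ⟪x, z i⟫ (v i), abs_real_inner_le_norm x (z i)]

lemma integrable_lse_inner {Ω : Type*} [MeasurableSpace Ω] {μ : Measure Ω} [IsFiniteMeasure μ]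
    {w : Ω → H} (hw : Integrable w μ) (z : ι → H) (v : ι → ℝ) :
    Integrable (fun ω => lse fun i => ⟪w ω, z i⟫ - v i) μ :=
  ((hw.norm.mul_const _).add (integrable_const _)).mono'
    ((continuous_lse_inner z v).comp_aestronglyMeasurable hw.aestronglyMeasurable)
    (ae_of_all _ fun ω => abs_lse_inner_le z v (w ω))

variable [MeasurableSpace H]

/-- The semi-discrete entropic Kantorovich functional of the potential `v`, for the transport of `γ`
to the points `z i` with weights `p i`, at unit regularization. -/
def dualFunctional (γ : Measure H) (z : ι → H) (p v : ι → ℝ) : ℝ :=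
  (∫ x, lse (fun i => ⟪x, z i⟫ - v i) ∂γ) + ∑ i, p i * v i

variable {γ : Measure H} [IsProbabilityMeasure γ] {z : ι → H} {p : ι → ℝ}

lemma dualFunctional_sub_const (hint : Integrable (fun x => x) γ) (hp1 : ∑ i, p i = 1)
    (v : ι → ℝ) (c : ℝ) :
    dualFunctional γ z p (fun i => v i - c) = dualFunctional γ z p v := by
  have h1 : ∀ x : H, lse (fun i => ⟪x, z i⟫ - (v i - c)) = lse (fun i => ⟪x, z i⟫ - v i) + c :=
    fun x => by
      rw [← lse_add_const]
      congr 1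
      ext i
      ring
  simp only [dualFunctional, h1, mul_sub, Finset.sum_sub_distrib, ← Finset.sum_mul, hp1]
  rw [integral_add (integrable_lse_inner hint z v) (integrable_const c)]
  simp

lemma continuous_dualFunctional (hint : Integrable (fun x => x) γ) :
    Continuous (dualFunctional γ z p) := by
  unfold dualFunctional
  refine Continuous.add ?_ (by fun_prop)
  refine (LipschitzWith.of_le_add_mul 1 fun u v => ?_).continuous
  simp only [NNReal.coe_one, one_mul]
  have : (∫ x, lse (fun i => ⟪x, z i⟫ - v i) ∂γ) + dist u v =
      ∫ x, (lse (fun i => ⟪x, z i⟫ - v i) + dist u v) ∂γ := by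
    rw [integral_add (integrable_lse_inner hint z v) (integrable_const _)]
    simp
  rw [this]
  refine integral_mono (integrable_lse_inner hint z u)
    ((integrable_lse_inner hint z v).add (integrable_const _)) fun x => ?_
  simp only
  rw [← lse_add_const]
  refine lse_mono fun i => ?_
  have := (abs_le.1 ((Real.dist_eq _ _).symm.le.trans (dist_le_pi_dist u v i))).1
  linarith

lemma exists_forall_dualFunctional_le (hint : Integrable (fun x => x) γ) (hp : ∀ i, 0 < p i)
    (hp1 : ∑ i, p i = 1) :
    ∃ v, ∀ u, dualFunctional γ z p v ≤ dualFunctional γ z p u := by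
  set Φ := dualFunctional γ z p with hΦ
  set C : ℝ := (∫ x, ‖x‖ ∂γ) * ∑ i, ‖z i‖ with hC
  -- Coercivity on nonnegative vectors with a vanishing coordinate.
  have hcoer : ∀ v : ι → ℝ, (∀ i, 0 ≤ v i) → (∃ j, v j = 0) → ∀ i, p i * v i ≤ Φ v + C := by
    rintro v hv ⟨j, hj⟩ i
    have h1 : -C ≤ ∫ x, lse (fun i => ⟪x, z i⟫ - v i) ∂γ := by
      rw [hC, ← integral_mul_const, ← integral_neg]
      refine integral_mono (hint.norm.mul_const _).neg (integrable_lse_inner hint z v) fun x => ?_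
      have h2 := le_lse (fun i => ⟪x, z i⟫ - v i) j
      have h3 := (abs_le.1 (abs_real_inner_le_norm x (z j))).1
      have h4 : ‖z j‖ ≤ ∑ i, ‖z i‖ :=
        Finset.single_le_sum (f := fun i => ‖z i‖) (fun j _ => norm_nonneg _) (Finset.mem_univ j)
      have h5 := mul_le_mul_of_nonneg_left h4 (norm_nonneg x)
      simp only [hj] at h2
      linarith
    have h2 : p i * v i ≤ ∑ i, p i * v i :=
      Finset.single_le_sum (f := fun i => p i * v i) (fun j _ => mul_nonneg (hp j).le (hv j))
        (Finset.mem_univ i)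
    simp only [hΦ, dualFunctional]
    linarith
  have hA : 0 ≤ Φ 0 + C := by
    have := hcoer 0 (fun _ => le_rfl) ⟨Classical.arbitrary ι, rfl⟩ (Classical.arbitrary ι)
    simpa using this
  set R : ι → ℝ := fun i => (Φ 0 + C) / p i with hR
  have h0 : (0 : ι → ℝ) ∈ Set.Icc 0 R := ⟨le_rfl, fun i => div_nonneg hA (hp i).le⟩
  obtain ⟨v, -, hv⟩ := (isCompact_Icc (a := (0 : ι → ℝ)) (b := R)).exists_isMinOn ⟨0, h0⟩
    (continuous_dualFunctional (z := z) (p := p) hint).continuousOn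
  refine ⟨v, fun u => ?_⟩
  obtain ⟨j, hj⟩ := Finite.exists_min u
  rw [hΦ, ← dualFunctional_sub_const hint hp1 u (u j), ← hΦ]
  set u' : ι → ℝ := fun i => u i - u j with hu'
  have hu0 : ∀ i, 0 ≤ u' i := fun i => sub_nonneg.2 (hj i)
  rcases le_total (Φ u') (Φ 0) with h | h
  · refine hv ⟨hu0, fun i => ?_⟩
    rw [hR, le_div_iff₀ (hp i), mul_comm]
    linarith [hcoer u' hu0 ⟨j, sub_self _⟩ i]
  · exact (hv h0).trans h

variable [BorelSpace H]

/-- First-order condition for the entropic dual: for suitable potentials `v`, the softmax kernel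
transports `γ` to the weights `p`. -/
theorem exists_integral_softmax_eq (hint : Integrable (fun x => x) γ) (z : ι → H)
    (hp : ∀ i, 0 < p i) (hp1 : ∑ i, p i = 1) :
    ∃ v : ι → ℝ, ∀ i, ∫ x, softmax (fun i => ⟪x, z i⟫ - v i) i ∂γ = p i := by
  classical
  obtain ⟨v, hv⟩ := exists_forall_dualFunctional_le (z := z) hint hp hp1
  refine ⟨v, fun i => ?_⟩
  set q : ℝ := ∫ x, softmax (fun i => ⟪x, z i⟫ - v i) i ∂γ with hq
  have hqint : Integrable (fun x : H => softmax (fun i => ⟪x, z i⟫ - v i) i) γ :=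
    (integrable_const (1 : ℝ)).mono'
      ((continuous_softmax i).comp (f := fun (x : H) i => ⟪x, z i⟫ - v i)
        (by fun_prop)).aestronglyMeasurable
      (ae_of_all _ fun x => by
        rw [Real.norm_eq_abs, abs_of_pos (softmax_pos _ _)]
        exact softmax_le_one _ _)
  have hnn : ∀ t : ℝ, 0 ≤ t * p i + (Real.exp (-t) - 1) * q := by
    intro t
    have h1 := hv (fun j => v j + Pi.single (M := fun _ => ℝ) i t j)
    have h2 : (∫ x, lse (fun j => ⟪x, z j⟫ - (v j + Pi.single (M := fun _ => ℝ) i t j)) ∂γ) ≤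
        (∫ x, lse (fun j => ⟪x, z j⟫ - v j) ∂γ) + (Real.exp (-t) - 1) * q := by
      rw [hq, ← integral_const_mul,
        ← integral_add (integrable_lse_inner hint z v) (hqint.const_mul _)]
      refine integral_mono (integrable_lse_inner hint z _)
        ((integrable_lse_inner hint z v).add (hqint.const_mul _)) fun x => ?_
      have h3 := lse_add_le (fun j => ⟪x, z j⟫ - v j)
        (fun j => -Pi.single (M := fun _ => ℝ) i t j)
      rw [Finset.sum_eq_single i (fun j _ hj => by simp [hj]) (by simp), Pi.single_eq_same,
        mul_comm (softmax _ _)] at h3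
      refine le_trans (le_of_eq ?_) h3
      congr 1
      ext j
      ring
    have h4 : ∑ j, p j * (v j + Pi.single (M := fun _ => ℝ) i t j) =
        (∑ j, p j * v j) + t * p i := by
      simp only [mul_add, Finset.sum_add_distrib]
      rw [Finset.sum_eq_single (f := fun j => p j * Pi.single (M := fun _ => ℝ) i t j) i
        (fun j _ hj => by simp [hj]) (by simp), Pi.single_eq_same, mul_comm t]
    simp only [dualFunctional, h4] at h1
    linarith
  have hd : HasDerivAt (fun t : ℝ => t * p i + (Real.exp (-t) - 1) * q) (p i - q) 0 := by
    have h1 := ((hasDerivAt_id (0 : ℝ)).mul_const (p i)).add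
      ((((hasDerivAt_id (0 : ℝ)).neg.exp).sub_const 1).mul_const q)
    refine h1.congr_deriv ?_
    simp
    ring
  have hmin : IsLocalMin (fun t : ℝ => t * p i + (Real.exp (-t) - 1) * q) 0 :=
    Filter.Eventually.of_forall fun t => by simpa using hnn t
  linarith [hmin.hasDerivAt_eq_zero hd]

end Potentials

section Coupling

variable {H : Type*} [NormedAddCommGroup H] [InnerProductSpace ℝ H]
  [SecondCountableTopology H] [MeasurableSpace H] [BorelSpace H]
  {ι : Type*} [Fintype ι] {γ : Measure H} [IsProbabilityMeasure γ]

/-- A finite continuous partition of unity `q` on `H` couples `γ` with the discrete measure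
`∑ (∫ q i) δ_{z i}`. -/
theorem sum_integral_mul_inner_le_width (hint : Integrable (fun x => x) γ) {q : ι → H → ℝ}
    (hq : ∀ i, Continuous (q i)) (hq0 : ∀ i x, 0 ≤ q i x) (hq1 : ∀ x, ∑ i, q i x = 1)
    (z : ι → H) :
    ((∑ i, ∫ x, q i x * ⟪x, z i⟫ ∂γ : ℝ) : EReal) ≤
      width γ (∑ i, ENNReal.ofReal (∫ x, q i x ∂γ) • Measure.dirac (z i)) := by
  have hqle : ∀ i x, q i x ≤ 1 := fun i x => (hq1 x) ▸
    Finset.single_le_sum (f := fun i => q i x) (fun j _ => hq0 j x) (Finset.mem_univ i)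
  have hqint : ∀ i, Integrable (q i) γ := fun i =>
    (integrable_const (1 : ℝ)).mono' (hq i).aestronglyMeasurable
      (ae_of_all _ fun x => by
        rw [Real.norm_eq_abs, abs_of_nonneg (hq0 i x)]
        exact hqle i x)
  have hqin : ∀ i, Integrable (fun x => q i x * ⟪x, z i⟫) γ := fun i => by
    refine (hint.norm.mul_const ‖z i‖).mono' (by have := hq i; fun_prop) (ae_of_all _ fun x => ?_)
    rw [norm_mul, Real.norm_eq_abs, abs_of_nonneg (hq0 i x)]
    exact (mul_le_of_le_one_left (norm_nonneg _) (hqle i x)).trans (norm_inner_le_norm x (z i))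
  set d : ι → Measure H := fun i => γ.withDensity fun x => ENNReal.ofReal (q i x) with hd
  have hmeas : ∀ i, Measurable fun x : H => (x, z i) := fun i => by fun_prop
  have hqm : ∀ i, Measurable fun x => ENNReal.ofReal (q i x) := fun i =>
    (hq i).measurable.ennreal_ofReal
  set π : Measure (H × H) := ∑ i, (d i).map fun x => (x, z i) with hπ
  have hfst : π.map Prod.fst = γ := by
    rw [hπ, Measure.map_finset_sum measurable_fst.aemeasurable]
    simp only [Measure.map_map measurable_fst (hmeas _), Function.comp_def, Measure.map_id']
    ext s hs
    simp only [Measure.finsetSum_apply, hd, withDensity_apply _ hs]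
    rw [← lintegral_finsetSum _ fun i _ => hqm i]
    simp only [← ENNReal.ofReal_sum_of_nonneg fun i _ => hq0 i _, hq1, ENNReal.ofReal_one,
      lintegral_one, Measure.restrict_apply_univ]
  have hsnd : π.map Prod.snd = ∑ i, ENNReal.ofReal (∫ x, q i x ∂γ) • Measure.dirac (z i) := by
    rw [hπ, Measure.map_finset_sum measurable_snd.aemeasurable]
    refine Finset.sum_congr rfl fun i _ => ?_
    rw [Measure.map_map measurable_snd (hmeas i)]
    simp only [Function.comp_def, Measure.map_const, hd, withDensity_apply _ MeasurableSet.univ,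
      Measure.restrict_univ]
    rw [ofReal_integral_eq_lintegral_ofReal (hqint i) (ae_of_all _ (hq0 i))]
  have hdint : ∀ i, Integrable (fun p : H × H => ⟪p.1, p.2⟫) ((d i).map fun x => (x, z i)) := by
    intro i
    rw [integrable_map_measure (by fun_prop) (hmeas i).aemeasurable,
      integrable_withDensity_iff_integrable_smul' (hqm i)
        (ae_of_all _ fun x => ENNReal.ofReal_lt_top)]
    simpa only [ENNReal.toReal_ofReal (hq0 i _), smul_eq_mul, Function.comp_apply] using hqin i
  have hval : ∫ p, ⟪p.1, p.2⟫ ∂π = ∑ i, ∫ x, q i x * ⟪x, z i⟫ ∂γ := by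
    rw [hπ, integral_finsetSum_measure fun i _ => hdint i]
    refine Finset.sum_congr rfl fun i _ => ?_
    rw [integral_map (hmeas i).aemeasurable (by fun_prop),
      integral_withDensity_eq_integral_toReal_smul (hqm i)
        (ae_of_all _ fun x => ENNReal.ofReal_lt_top)]
    simp only [ENNReal.toReal_ofReal (hq0 i _), smul_eq_mul]
  rw [← hval]
  exact le_iSup_of_le π (le_iSup_of_le ⟨hfst, hsnd⟩
    (le_iSup_of_le (integrable_finsetSum_measure.2 fun i _ => hdint i) le_rfl))

end Coupling

/-! ### Transport-entropy estimates for tilted measures -/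

/-- The Gibbs variational inequality. The first term on the right is the relative entropy of
`μ.tilted f` with respect to `μ`. -/
lemma integral_tilted_le {Ω : Type*} [MeasurableSpace Ω] {μ : Measure Ω} [IsProbabilityMeasure μ]
    {f h : Ω → ℝ} (hf : Integrable (fun ω => Real.exp (f ω)) μ) (hfQ : Integrable f (μ.tilted f))
    (hhQ : Integrable h (μ.tilted f)) (hh : Integrable (fun ω => Real.exp (h ω)) μ) :
    ∫ ω, h ω ∂μ.tilted f ≤ (∫ ω, f ω ∂μ.tilted f) - Real.log (∫ ω, Real.exp (f ω) ∂μ) +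
      Real.log (∫ ω, Real.exp (h ω) ∂μ) := by
  have := isProbabilityMeasure_tilted hf
  set Z := ∫ ω, Real.exp (f ω) ∂μ with hZ
  set W := ∫ ω, Real.exp (h ω) ∂μ with hW
  have hZ0 : 0 < Z := integral_exp_pos hf
  have hW0 : 0 < W := integral_exp_pos hh
  have hi : Integrable (fun ω => Real.exp (h ω - f ω)) (μ.tilted f) := by
    rw [integrable_tilted_iff hf]
    refine hh.congr (ae_of_all _ fun ω => ?_)
    simp only [smul_eq_mul]
    rw [← Real.exp_add, add_sub_cancel]
  have hval : ∫ ω, Real.exp (h ω - f ω) ∂μ.tilted f = W / Z := by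
    have := integral_exp_tilted (μ := μ) f (h - f)
    simpa using this
  have hi1 : Integrable (fun ω => Z / W * Real.exp (h ω - f ω) - 1) (μ.tilted f) :=
    (hi.const_mul _).sub (integrable_const _)
  have hle : ∫ ω, (h ω - f ω) ∂μ.tilted f ≤
      ∫ ω, (Z / W * Real.exp (h ω - f ω) - 1 + (Real.log W - Real.log Z)) ∂μ.tilted f := by
    refine integral_mono (hhQ.sub hfQ)
      (hi1.add (integrable_const _)) fun ω => ?_
    have h1 := Real.add_one_le_exp (h ω - f ω + (Real.log Z - Real.log W))
    rw [Real.exp_add, Real.exp_sub (Real.log Z), Real.exp_log hZ0, Real.exp_log hW0] at h1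
    simp only
    linarith
  rw [integral_sub hhQ hfQ, integral_add hi1 (integrable_const _),
    integral_sub (hi.const_mul _) (integrable_const _),
    integral_const_mul, hval] at hle
  have : Z / W * (W / Z) = 1 := by field_simp
  simp only [this, integral_const, probReal_univ, one_smul, sub_self, zero_add] at hle
  linarith

section Transport

variable {H : Type*} [NormedAddCommGroup H] [InnerProductSpace ℝ H] [CompleteSpace H]
  [SecondCountableTopology H] [MeasurableSpace H] [BorelSpace H]
  {Ω : Type*} [MeasurableSpace Ω] {P : Measure Ω} [IsProbabilityMeasure P]
  {γ : Measure H} {w : Ω → H} {f : Ω → ℝ}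

/-- Optimality of the entropic potentials `v`, Young's inequality
`⟪w, z⟫ ≤ (⟪w, z⟫ - v - s ‖z‖² / 2) + v + s ‖z‖² / 2`, the Gibbs inequality for `s U_s (w)` and the
Hamilton–Jacobi estimate for `U_s`. The term `log (card ι)` is the price of entropic
regularization. -/
lemma exists_kernel_integral_inner_le {ι : Type*} [Fintype ι] [Nonempty ι] [MeasurableSpace ι]
    [MeasurableSingletonClass ι]
    (hγ : LogSobolev γ) (hint : Integrable (fun x => x) γ) (hw : HasLaw w γ P)
    (hf : Integrable (fun ω => Real.exp (f ω)) P) (hfQ : Integrable f (P.tilted f))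
    (hwQ : Integrable w (P.tilted f)) {j : Ω → ι} (hj : Measurable j)
    (hpos : ∀ i, 0 < (P.tilted f).real (j ⁻¹' {i})) (z : ι → H) {s : ℝ} (hs : 0 < s) :
    ∃ q : ι → H → ℝ, (∀ i, Continuous (q i)) ∧ (∀ i x, 0 ≤ q i x) ∧ (∀ x, ∑ i, q i x = 1) ∧
      (∀ i, ∫ x, q i x ∂γ = (P.tilted f).real (j ⁻¹' {i})) ∧
      ∫ ω, ⟪w ω, z (j ω)⟫ ∂P.tilted f ≤ (∑ i, ∫ x, q i x * ⟪x, z i⟫ ∂γ) +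
        Real.log (Fintype.card ι) +
        ((∫ ω, f ω ∂P.tilted f) - Real.log (∫ ω, Real.exp (f ω) ∂P)) / s +
        s * ∫ ω, ‖z (j ω)‖ ^ 2 / 2 ∂P.tilted f := by
  have : IsProbabilityMeasure γ := hw.isProbabilityMeasure_iff.1 inferInstance
  set Q := P.tilted f with hQ
  have : IsProbabilityMeasure Q := isProbabilityMeasure_tilted hf
  have hFint : ∀ F : ι → ℝ, Integrable (fun ω => F (j ω)) Q := fun F => by
    have : Integrable F (Q.map j) :=
      have := Measure.isProbabilityMeasure_map (μ := Q) hj.aemeasurable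
      Integrable.of_finite
    exact this.comp_measurable hj
  have hF : ∀ F : ι → ℝ, ∫ ω, F (j ω) ∂Q = ∑ i, Q.real (j ⁻¹' {i}) * F i := fun F => by
    have := Measure.isProbabilityMeasure_map (μ := Q) hj.aemeasurable
    rw [← integral_map hj.aemeasurable (f := F) Integrable.of_finite.aestronglyMeasurable,
      integral_fintype Integrable.of_finite]
    refine Finset.sum_congr rfl fun i _ => ?_
    rw [map_measureReal_apply hj (measurableSet_singleton i), smul_eq_mul]
  obtain ⟨v, hv⟩ := exists_integral_softmax_eq hint z hpos (by
    have := hF fun _ => 1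
    simpa using this.symm)
  set q : ι → H → ℝ := fun i x => softmax (fun i => ⟪x, z i⟫ - v i) i with hq
  have hqc : ∀ i, Continuous (q i) := fun i =>
    (continuous_softmax i).comp (f := fun (x : H) i => ⟪x, z i⟫ - v i) (by fun_prop)
  refine ⟨q, hqc, fun i x => (softmax_pos _ i).le, fun x => sum_softmax _, hv, ?_⟩
  have hqi : ∀ i, Integrable (q i) γ := fun i =>
    (integrable_const (1 : ℝ)).mono' (hqc i).aestronglyMeasurable (ae_of_all _ fun x => by
      rw [Real.norm_eq_abs, abs_of_pos (softmax_pos _ _)]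
      exact softmax_le_one _ _)
  have hqin : ∀ i, Integrable (fun x => q i x * ⟪x, z i⟫) γ := fun i => by
    refine (hint.norm.mul_const ‖z i‖).mono' (by have := hqc i; fun_prop) (ae_of_all _ fun x => ?_)
    rw [norm_mul, Real.norm_eq_abs, abs_of_pos (softmax_pos _ _)]
    exact (mul_le_of_le_one_left (norm_nonneg _) (softmax_le_one _ _)).trans
      (norm_inner_le_norm x (z i))
  set U : H → ℝ := fun x => lse fun i => ⟪x, z i⟫ - v i - s * (‖z i‖ ^ 2 / 2) with hU
  have hUeq : U = fun x => lse fun i => ⟪x, z i⟫ - (v i + s * (‖z i‖ ^ 2 / 2)) := by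
    simp only [hU, sub_sub]
  have hUQ : Integrable (fun ω => U (w ω)) Q := by
    rw [hUeq]
    exact integrable_lse_inner hwQ z _
  have hUc : Continuous U := hUeq ▸ continuous_lse_inner z _
  obtain ⟨hHJ1, hHJ2⟩ := integral_exp_lse_le hγ hint z v hs
  have hexpP : Integrable (fun ω => Real.exp (s * U (w ω))) P := by
    rw [← hw.map_eq] at hHJ1
    exact hHJ1.comp_aemeasurable hw.aemeasurable
  have hexpval : ∫ ω, Real.exp (s * U (w ω)) ∂P = ∫ x, Real.exp (s * U x) ∂γ := by
    rw [← hw.map_eq, integral_map hw.aemeasurable (by fun_prop)]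
  have hgibbs := integral_tilted_le hf hfQ (hUQ.const_mul s) hexpP
  rw [integral_const_mul, hexpval] at hgibbs
  have hlog : Real.log (∫ x, Real.exp (s * U x) ∂γ) ≤
      s * ∫ x, lse (fun i => ⟪x, z i⟫ - v i) ∂γ := by
    rw [Real.log_le_iff_le_exp (integral_exp_pos hHJ1)]
    exact hHJ2
  -- The kernel `q` is almost optimal for the entropic dual.
  have hdual : ∫ x, lse (fun i => ⟪x, z i⟫ - v i) ∂γ ≤
      (∑ i, ∫ x, q i x * ⟪x, z i⟫ ∂γ) - ∑ i, Q.real (j ⁻¹' {i}) * v i +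
        Real.log (Fintype.card ι) := by
    have hterm : ∀ i, Integrable (fun x => q i x * ⟪x, z i⟫ - q i x * v i) γ := fun i =>
      (hqin i).sub ((hqi i).mul_const _)
    have hsum : Integrable (fun x => ∑ i, (q i x * ⟪x, z i⟫ - q i x * v i)) γ :=
      integrable_finsetSum _ fun i _ => hterm i
    have h1 : (∑ i, ∫ x, q i x * ⟪x, z i⟫ ∂γ) - (∑ i, Q.real (j ⁻¹' {i}) * v i) +
        Real.log (Fintype.card ι) =
        ∫ x, ((∑ i, (q i x * ⟪x, z i⟫ - q i x * v i)) + Real.log (Fintype.card ι)) ∂γ := by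
      rw [integral_add hsum (integrable_const _),
        integral_finsetSum _ fun i _ => hterm i]
      simp only [integral_sub (hqin _) ((hqi _).mul_const _), integral_mul_const,
        Finset.sum_sub_distrib, integral_const, probReal_univ, one_smul]
      congr 2
      exact Finset.sum_congr rfl fun i _ => by rw [← hv i]
    rw [h1]
    refine integral_mono (integrable_lse_inner hint z v)
      (hsum.add (integrable_const _)) fun x => ?_
    simpa only [mul_sub] using lse_le_sum_softmax_mul fun i => ⟪x, z i⟫ - v i
  have hmom : Integrable (fun ω => s * (‖z (j ω)‖ ^ 2 / 2)) Q :=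
    (hFint fun i => ‖z i‖ ^ 2 / 2).const_mul s
  have hpen : Integrable (fun ω => v (j ω) + s * (‖z (j ω)‖ ^ 2 / 2)) Q := (hFint v).add hmom
  have hyoung : ∫ ω, ⟪w ω, z (j ω)⟫ ∂Q ≤
      ∫ ω, (U (w ω) + (v (j ω) + s * (‖z (j ω)‖ ^ 2 / 2))) ∂Q := by
    refine integral_mono ?_ (hUQ.add hpen) fun ω => ?_
    · refine (hwQ.norm.mul_const (∑ i, ‖z i‖)).mono' ?_ (ae_of_all _ fun ω => ?_)
      · have h1 : Measurable fun ω => z (j ω) := (measurable_of_finite z).comp hj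
        have h2 := hwQ.aestronglyMeasurable
        exact h2.inner h1.aestronglyMeasurable
      · refine (norm_inner_le_norm _ _).trans (mul_le_mul_of_nonneg_left ?_ (norm_nonneg _))
        exact Finset.single_le_sum (f := fun i => ‖z i‖) (fun i _ => norm_nonneg _)
          (Finset.mem_univ (j ω))
    · have := le_lse (fun i => ⟪w ω, z i⟫ - v i - s * (‖z i‖ ^ 2 / 2)) (j ω)
      simp only [hU]
      linarith
  rw [integral_add hUQ hpen, integral_add (hFint v) hmom, integral_const_mul, hF v] at hyoung
  set ε := (∫ ω, f ω ∂Q) - Real.log (∫ ω, Real.exp (f ω) ∂P) with hε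
  have hU1 : ∫ ω, U (w ω) ∂Q ≤ ε / s + ∫ x, lse (fun i => ⟪x, z i⟫ - v i) ∂γ := by
    rw [← sub_le_iff_le_add, le_div_iff₀ hs]
    linarith
  linarith

/-- Replacing `z` by `β z` and `s` by `s / β` leaves the entropy and the moment term unchanged after
division by `β`, and makes the regularization cost `log (card ι) / β` disappear as `β → ∞`. -/
lemma integral_inner_le_of_fintype {ι : Type*} [Fintype ι] [Nonempty ι] [MeasurableSpace ι]
    [MeasurableSingletonClass ι]
    (hγ : LogSobolev γ) (hint : Integrable (fun x => x) γ) (hw : HasLaw w γ P)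
    (hf : Integrable (fun ω => Real.exp (f ω)) P) (hfQ : Integrable f (P.tilted f))
    (hwQ : Integrable w (P.tilted f)) {j : Ω → ι} (hj : Measurable j)
    (hpos : ∀ i, 0 < (P.tilted f).real (j ⁻¹' {i})) (z : ι → H) {s B : ℝ} (hs : 0 < s)
    (hB : width γ ((P.tilted f).map fun ω => z (j ω)) ≤ (B : EReal)) :
    ∫ ω, ⟪w ω, z (j ω)⟫ ∂P.tilted f ≤ B +
        ((∫ ω, f ω ∂P.tilted f) - Real.log (∫ ω, Real.exp (f ω) ∂P)) / s +
        s * ∫ ω, ‖z (j ω)‖ ^ 2 / 2 ∂P.tilted f := by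
  have : IsProbabilityMeasure γ := hw.isProbabilityMeasure_iff.1 inferInstance
  have hQp : IsProbabilityMeasure (P.tilted f) := isProbabilityMeasure_tilted hf
  have hmap : (P.tilted f).map (fun ω => z (j ω)) =
      ∑ i, ENNReal.ofReal ((P.tilted f).real (j ⁻¹' {i})) • Measure.dirac (z i) := by
    have hz := measurable_of_finite z
    have h1 := Measure.map_eq_sum (P.tilted f) j hj
    rw [Measure.sum_fintype] at h1
    have h2 : (P.tilted f).map (fun ω => z (j ω)) = ((P.tilted f).map j).map z :=
      (Measure.map_map hz hj).symm
    rw [h2, h1, Measure.map_finset_sum hz.aemeasurable]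
    refine Finset.sum_congr rfl fun i _ => ?_
    rw [Measure.map_smul, Measure.map_dirac' hz, ofReal_measureReal]
  set ε := (∫ ω, f ω ∂P.tilted f) - Real.log (∫ ω, Real.exp (f ω) ∂P) with hε
  have key : ∀ β : ℝ, 0 < β → ∫ ω, ⟪w ω, z (j ω)⟫ ∂P.tilted f ≤
      (B + ε / s + s * ∫ ω, ‖z (j ω)‖ ^ 2 / 2 ∂P.tilted f) + β⁻¹ * Real.log (Fintype.card ι) := by
    intro β hβ
    obtain ⟨q, hqc, hq0, hq1, hqp, hle⟩ := exists_kernel_integral_inner_le hγ hint hw hf hfQ hwQ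
      hj hpos (fun i => β • z i) (div_pos hs hβ)
    have hqB := sum_integral_mul_inner_le_width hint hqc hq0 hq1 z
    simp only [hqp, ← hmap] at hqB
    have hqB' := EReal.coe_le_coe_iff.1 (hqB.trans hB)
    simp only [inner_smul_right, norm_smul, mul_pow, Real.norm_eq_abs, sq_abs, mul_left_comm _ β,
      mul_div_assoc, integral_const_mul, ← Finset.mul_sum, ← hε] at hle
    have e1 : ε / (s / β) = β * (ε / s) := by field_simp
    have e2 : ∀ A : ℝ, s / β * (β ^ 2 * A) = β * (s * A) := fun A => by field_simp
    rw [e1, e2] at hle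
    have e3 : β * (β⁻¹ * Real.log (Fintype.card ι)) = Real.log (Fintype.card ι) := by field_simp
    refine le_of_mul_le_mul_left ?_ hβ
    have := mul_le_mul_of_nonneg_left hqB' hβ.le
    simp only [mul_add]
    rw [e3]
    linarith
  have hlim : Filter.Tendsto (fun β : ℝ =>
      (B + ε / s + s * ∫ ω, ‖z (j ω)‖ ^ 2 / 2 ∂P.tilted f) + β⁻¹ * Real.log (Fintype.card ι))
      Filter.atTop (nhds ((B + ε / s + s * ∫ ω, ‖z (j ω)‖ ^ 2 / 2 ∂P.tilted f) +
        0 * Real.log (Fintype.card ι))) :=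
    (tendsto_inv_atTop_zero.mul_const _).const_add _
  rw [zero_mul, add_zero] at hlim
  refine ge_of_tendsto hlim ?_
  filter_upwards [Filter.eventually_gt_atTop 0] with β hβ using key β hβ

lemma integral_inner_le_of_finite_range
    (hγ : LogSobolev γ) (hint : Integrable (fun x => x) γ) (hw : HasLaw w γ P)
    (hf : Integrable (fun ω => Real.exp (f ω)) P) (hfQ : Integrable f (P.tilted f))
    (hwQ : Integrable w (P.tilted f)) {k : Ω → H} (hk : Measurable k) (hfin : (Set.range k).Finite)
    {s B : ℝ} (hs : 0 < s) (hB : width γ ((P.tilted f).map k) ≤ (B : EReal)) :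
    ∫ ω, ⟪w ω, k ω⟫ ∂P.tilted f ≤ B +
        ((∫ ω, f ω ∂P.tilted f) - Real.log (∫ ω, Real.exp (f ω) ∂P)) / s +
        s * ∫ ω, ‖k ω‖ ^ 2 / 2 ∂P.tilted f := by
  classical
  have hQp : IsProbabilityMeasure (P.tilted f) := isProbabilityMeasure_tilted hf
  -- Only the values taken with positive probability matter.
  set S : Finset H := hfin.toFinset.filter fun x => 0 < (P.tilted f).real (k ⁻¹' {x}) with hS
  have hkS : ∀ᵐ ω ∂P.tilted f, k ω ∈ S := by
    have h0 : P.tilted f (⋃ x ∈ ((hfin.toFinset \ S : Finset H) : Set H), k ⁻¹' {x}) = 0 := by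
      rw [measure_biUnion_null_iff (Finset.countable_toSet _)]
      intro x hx
      have hx := Finset.mem_sdiff.1 hx
      have : ¬ 0 < (P.tilted f).real (k ⁻¹' {x}) := fun h =>
        hx.2 (Finset.mem_filter.2 ⟨hx.1, h⟩)
      exact (measureReal_eq_zero_iff).1 (le_antisymm (not_lt.1 this) measureReal_nonneg)
    filter_upwards [measure_eq_zero_iff_ae_notMem.1 h0] with ω hω
    by_contra hc
    refine hω ?_
    simp only [Set.mem_iUnion]
    exact ⟨k ω, Finset.mem_sdiff.2 ⟨hfin.mem_toFinset.2 ⟨ω, rfl⟩, hc⟩, rfl⟩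
  obtain ⟨ω₀, hω₀⟩ := hkS.exists
  set k' : Ω → H := fun ω => if k ω ∈ S then k ω else k ω₀ with hk'
  have hSm : MeasurableSet {ω | k ω ∈ S} := hk S.measurableSet
  have hk'm : Measurable k' := Measurable.ite hSm hk measurable_const
  have hk'S : ∀ ω, k' ω ∈ S := fun ω => by
    simp only [hk']
    split_ifs with h
    exacts [h, hω₀]
  have hkk' : k =ᵐ[P.tilted f] k' := by
    filter_upwards [hkS] with ω hω
    simp [hk', hω]
  set j : Ω → S := fun ω => ⟨k' ω, hk'S ω⟩ with hj
  have hjm : Measurable j := hk'm.subtype_mk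
  have hne : Nonempty S := ⟨j ω₀⟩
  have hpos : ∀ i, 0 < (P.tilted f).real (j ⁻¹' {i}) := by
    rintro ⟨x, hx⟩
    have h1 : (P.tilted f).real (j ⁻¹' {⟨x, hx⟩}) = (P.tilted f).real (k ⁻¹' {x}) := by
      refine measureReal_congr ?_
      filter_upwards [hkk'] with ω hω
      have : (j ω = ⟨x, hx⟩) = (k ω = x) := by
        rw [hω, hj]
        simp
      exact this
    rw [h1]
    exact (Finset.mem_filter.1 hx).2
  have hmain := integral_inner_le_of_fintype hγ hint hw hf hfQ hwQ hjm hpos (fun i => (i : H)) hs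
    (B := B) (by rwa [Measure.map_congr hkk'] at hB)
  have e1 : ∫ ω, ⟪w ω, k ω⟫ ∂P.tilted f = ∫ ω, ⟪w ω, (j ω : H)⟫ ∂P.tilted f :=
    integral_congr_ae (by filter_upwards [hkk'] with ω hω; rw [hω])
  have e2 : ∫ ω, ‖k ω‖ ^ 2 / 2 ∂P.tilted f = ∫ ω, ‖(j ω : H)‖ ^ 2 / 2 ∂P.tilted f :=
    integral_congr_ae (by filter_upwards [hkk'] with ω hω; rw [hω])
  rw [e1, e2]
  exact hmain

end Transport

/-- A finite-valued measurable approximation of the identity on a compact set that does not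
increase the norm: each piece of a finite cover is sent to its point of least norm. -/
lemma exists_finite_range_approx {H : Type*} [NormedAddCommGroup H] [MeasurableSpace H]
    [BorelSpace H] {K : Set H} (hK : IsCompact K) {δ : ℝ} (hδ : 0 < δ) :
    ∃ r : H → H, Measurable r ∧ (Set.range r).Finite ∧
      ∀ x ∈ K, r x ∈ K ∧ ‖r x‖ ≤ ‖x‖ ∧ ‖x - r x‖ ≤ δ := by
  classical
  have key : ∀ t : Finset H, ∃ r : H → H, Measurable r ∧ (Set.range r).Finite ∧
      ∀ x ∈ K, (∃ c ∈ t, x ∈ Metric.closedBall c (δ / 2)) →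
        r x ∈ K ∧ ‖r x‖ ≤ ‖x‖ ∧ ‖x - r x‖ ≤ δ := by
    intro t
    induction t using Finset.induction_on with
    | empty => exact ⟨fun _ => 0, measurable_const, Set.finite_range_const, by simp⟩
    | insert c t _ ih =>
      obtain ⟨r, hr, hfin, hgood⟩ := ih
      rcases (K ∩ Metric.closedBall c (δ / 2)).eq_empty_or_nonempty with he | hne
      · refine ⟨r, hr, hfin, fun x hx ⟨d, hd, hxd⟩ => ?_⟩
        rcases Finset.mem_insert.1 hd with rfl | hd
        · exact absurd (he ▸ ⟨hx, hxd⟩ : x ∈ (∅ : Set H)) (Set.notMem_empty x)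
        · exact hgood x hx ⟨d, hd, hxd⟩
      · obtain ⟨y, hy, hmin⟩ := (hK.inter_right Metric.isClosed_closedBall).exists_isMinOn hne
          continuous_norm.continuousOn
        refine ⟨fun x => if x ∈ Metric.closedBall c (δ / 2) then y else r x,
          Measurable.ite Metric.isClosed_closedBall.measurableSet measurable_const hr,
          (hfin.insert y).subset ?_, fun x hx ⟨d, hd, hxd⟩ => ?_⟩
        · rintro _ ⟨x, rfl⟩
          by_cases h : x ∈ Metric.closedBall c (δ / 2)
          · simp only [h, if_true]
            exact Set.mem_insert _ _
          · simp only [h, if_false]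
            exact Set.mem_insert_of_mem _ ⟨x, rfl⟩
        · by_cases h : x ∈ Metric.closedBall c (δ / 2)
          · simp only [h, if_true]
            refine ⟨hy.1, hmin ⟨hx, h⟩, ?_⟩
            rw [← dist_eq_norm]
            have := dist_triangle_right x y c
            have h1 := Metric.mem_closedBall.1 h
            have h2 := Metric.mem_closedBall.1 hy.2
            linarith
          · simp only [h, if_false]
            rcases Finset.mem_insert.1 hd with rfl | hd
            · exact absurd hxd h
            · exact hgood x hx ⟨d, hd, hxd⟩
  obtain ⟨t, -, htf, ht⟩ := hK.finite_cover_balls (half_pos hδ)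
  obtain ⟨r, hr, hfin, hgood⟩ := key htf.toFinset
  refine ⟨r, hr, hfin, fun x hx => hgood x hx ?_⟩
  obtain ⟨c, hc, hxc⟩ := Set.mem_iUnion₂.1 (ht hx)
  exact ⟨c, htf.mem_toFinset.2 hc, Metric.ball_subset_closedBall hxc⟩

section Transport

variable {H : Type*} [NormedAddCommGroup H] [InnerProductSpace ℝ H] [CompleteSpace H]
  [SecondCountableTopology H] [MeasurableSpace H] [BorelSpace H]
  {Ω : Type*} [MeasurableSpace Ω] {P : Measure Ω} [IsProbabilityMeasure P]
  {γ : Measure H} {w : Ω → H} {f : Ω → ℝ}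

/-- Dual form of the estimate `E_Q⟪w, z⟫ ≤ w(law of z) + √(2 KL(Q ‖ P) E_Q ‖z‖²)` for the tilted
measure `Q`. -/
theorem integral_inner_tilted_le
    (hγ : LogSobolev γ) (hint : Integrable (fun x => x) γ) (hw : HasLaw w γ P)
    (hf : Integrable (fun ω => Real.exp (f ω)) P) (hfQ : Integrable f (P.tilted f))
    (hwQ : Integrable w (P.tilted f)) {K : Set H} (hK : IsCompact K)
    {z : Ω → H} (hz : Measurable z) (hzK : ∀ᵐ ω ∂P, z ω ∈ K)
    {s B : ℝ} (hs : 0 < s)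
    (hB : ∀ μ : Measure H, IsProbabilityMeasure μ → (∀ᵐ x ∂μ, x ∈ K) →
      Integrable (fun x => ‖x‖ ^ 2) μ → ∫ x, ‖x‖ ^ 2 ∂μ ≤ ∫ ω, ‖z ω‖ ^ 2 ∂P.tilted f →
      width γ μ ≤ (B : EReal)) :
    ∫ ω, ⟪w ω, z ω⟫ ∂P.tilted f ≤ B +
        ((∫ ω, f ω ∂P.tilted f) - Real.log (∫ ω, Real.exp (f ω) ∂P)) / s +
        s * ((∫ ω, ‖z ω‖ ^ 2 ∂P.tilted f) / 2) := by
  have hQp : IsProbabilityMeasure (P.tilted f) := isProbabilityMeasure_tilted hf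
  set Q := P.tilted f with hQ
  have hzQ : ∀ᵐ ω ∂Q, z ω ∈ K := (tilted_absolutelyContinuous P f).ae_le hzK
  obtain ⟨R, hR⟩ := hK.isBounded.exists_norm_le
  have hsq : ∀ {u : Ω → H}, Measurable u → (∀ᵐ ω ∂Q, u ω ∈ K) →
      Integrable (fun ω => ‖u ω‖ ^ 2) Q := fun hu huK => by
    refine (integrable_const (R ^ 2)).mono' (hu.norm.pow_const 2).aestronglyMeasurable ?_
    filter_upwards [huK] with ω hω
    rw [Real.norm_eq_abs, abs_of_nonneg (by positivity)]
    exact pow_le_pow_left₀ (norm_nonneg _) (hR _ hω) 2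
  have hin : ∀ {u : Ω → H}, Measurable u → (∀ᵐ ω ∂Q, u ω ∈ K) →
      Integrable (fun ω => ⟪w ω, u ω⟫) Q := fun hu huK => by
    refine (hwQ.norm.mul_const R).mono'
      (hwQ.aestronglyMeasurable.inner hu.aestronglyMeasurable) ?_
    filter_upwards [huK] with ω hω
    exact (norm_inner_le_norm _ _).trans
      (mul_le_mul_of_nonneg_left (hR _ hω) (norm_nonneg _))
  set ε := (∫ ω, f ω ∂Q) - Real.log (∫ ω, Real.exp (f ω) ∂P) with hε
  have key : ∀ δ : ℝ, 0 < δ → ∫ ω, ⟪w ω, z ω⟫ ∂Q ≤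
      (B + ε / s + s * ((∫ ω, ‖z ω‖ ^ 2 ∂Q) / 2)) + δ * ∫ ω, ‖w ω‖ ∂Q := by
    intro δ hδ
    obtain ⟨r, hr, hfin, hgood⟩ := exists_finite_range_approx hK hδ
    have hk : Measurable fun ω => r (z ω) := hr.comp hz
    have hkK : ∀ᵐ ω ∂Q, r (z ω) ∈ K := by
      filter_upwards [hzQ] with ω hω using (hgood _ hω).1
    have hle : ∫ ω, ‖r (z ω)‖ ^ 2 ∂Q ≤ ∫ ω, ‖z ω‖ ^ 2 ∂Q := by
      refine integral_mono_ae (hsq hk hkK) (hsq hz hzQ) ?_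
      filter_upwards [hzQ] with ω hω
      exact pow_le_pow_left₀ (norm_nonneg _) (hgood _ hω).2.1 2
    have hmain := integral_inner_le_of_finite_range hγ hint hw hf hfQ hwQ hk
      (hfin.subset (Set.range_comp_subset_range z r)) hs (B := B)
      (hB _ (Measure.isProbabilityMeasure_map hk.aemeasurable)
        ((ae_map_iff hk.aemeasurable hK.measurableSet).2 hkK)
        ((integrable_map_measure (by fun_prop) hk.aemeasurable).2 (hsq hk hkK))
        (by rw [integral_map hk.aemeasurable (by fun_prop)]; exact hle))
    rw [integral_div] at hmain
    have hdiff : ∫ ω, ⟪w ω, z ω⟫ ∂Q ≤ ∫ ω, (⟪w ω, r (z ω)⟫ + δ * ‖w ω‖) ∂Q := by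
      refine integral_mono_ae (hin hz hzQ) ((hin hk hkK).add (hwQ.norm.const_mul δ)) ?_
      filter_upwards [hzQ] with ω hω
      have h1 := real_inner_le_norm (w ω) (z ω - r (z ω))
      have h2 := mul_le_mul_of_nonneg_left (hgood _ hω).2.2 (norm_nonneg (w ω))
      rw [inner_sub_right] at h1
      linarith
    rw [integral_add (hin hk hkK) (hwQ.norm.const_mul δ), integral_const_mul] at hdiff
    have := mul_le_mul_of_nonneg_left (div_le_div_of_nonneg_right hle zero_le_two) hs.le
    linarith
  have hlim : Filter.Tendsto (fun δ : ℝ =>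
      (B + ε / s + s * ((∫ ω, ‖z ω‖ ^ 2 ∂Q) / 2)) + δ * ∫ ω, ‖w ω‖ ∂Q)
      (nhdsWithin 0 (Set.Ioi 0)) (nhds ((B + ε / s + s * ((∫ ω, ‖z ω‖ ^ 2 ∂Q) / 2)) +
        0 * ∫ ω, ‖w ω‖ ∂Q)) :=
    (((Filter.tendsto_id.mono_left nhdsWithin_le_nhds)).mul_const _).const_add _
  rw [zero_mul, add_zero] at hlim
  refine ge_of_tendsto hlim ?_
  filter_upwards [self_mem_nhdsWithin] with δ hδ using key δ hδ

end Transport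

/-! ### Empirical risk minimization -/

section BasicInequality

lemma sq_norm_le_of_card_mul_le {H : Type*} [NormedAddCommGroup H] [InnerProductSpace ℝ H] {n : ℕ}
    (hn : 0 < n) {z u : H}
    (h : (n : ℝ) * ‖z‖ ^ 2 ≤ 2 * (√(n : ℝ) * ⟪u, z⟫)) :
    ‖z‖ ^ 2 ≤ 2 / √(n : ℝ) * ⟪u, z⟫ := by
  have hn' : (0 : ℝ) < n := by exact_mod_cast hn
  have hs : 0 < √(n : ℝ) := Real.sqrt_pos.2 hn'
  have hsq : √(n : ℝ) * √(n : ℝ) = n := Real.mul_self_sqrt hn'.le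
  nth_rewrite 1 [← hsq] at h
  rw [div_mul_eq_mul_div, le_div_iff₀ hs]
  refine le_of_mul_le_mul_left ?_ hs
  linarith

variable {H : Type*} [NormedAddCommGroup H] [InnerProductSpace ℝ H]
  {Ω : Type*} [MeasurableSpace Ω] {P : Measure Ω} {n : ℕ} {T : Set H} {m : H}
  {w mhat : Ω → H}

/-- The basic inequality: `mhat` has at most the empirical risk of `m`. -/
lemma IsMeanEstimation.sq_norm_sub_le [MeasurableSpace H] {X : Fin n → Ω → H} (hn : 0 < n)
    (hm : m ∈ T)
    (h : IsMeanEstimation P n T m X w mhat) :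
    ∀ᵐ ω ∂P, mhat ω ∈ T ∧ ‖mhat ω - m‖ ^ 2 ≤ 2 / √(n : ℝ) * ⟪w ω, mhat ω - m⟫ := by
  have hn' : (0 : ℝ) < n := by exact_mod_cast hn
  filter_upwards [h.erm] with ω hω
  refine ⟨hω.1, sq_norm_le_of_card_mul_le hn ?_⟩
  have h1 : 1 / (n : ℝ) * ∑ i, ‖mhat ω - X i ω‖ ^ 2 ≤ 1 / (n : ℝ) * ∑ i, ‖m - X i ω‖ ^ 2 :=
    hω.2 hm
  have h2 := le_of_mul_le_mul_left h1 (by positivity)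
  have h3 : ∀ i, ‖mhat ω - X i ω‖ ^ 2 =
      ‖mhat ω - m‖ ^ 2 + 2 * ⟪m - X i ω, mhat ω - m⟫ + ‖m - X i ω‖ ^ 2 := fun i => by
    rw [← sub_add_sub_cancel (mhat ω) m (X i ω), norm_add_sq_real,
      real_inner_comm (m - X i ω) (mhat ω - m)]
  have h4 : √(n : ℝ) * ⟪w ω, mhat ω - m⟫ = -∑ i, ⟪m - X i ω, mhat ω - m⟫ := by
    rw [h.noise ω, ← sum_inner, ← inner_neg_left, ← real_inner_smul_left, smul_smul,
      Real.mul_self_sqrt hn'.le, smul_sub, smul_smul, mul_one_div_cancel hn'.ne', one_smul,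
      Finset.sum_sub_distrib, neg_sub]
    simp [Nat.cast_smul_eq_nsmul]
  simp only [h3, Finset.sum_add_distrib, Finset.sum_const, Finset.card_univ, Fintype.card_fin,
    nsmul_eq_mul, ← Finset.mul_sum] at h2
  rw [h4]
  linarith

lemma IsRegression.sq_norm_sub_le {Y : Ω → H} (hn : 0 < n) (hm : m ∈ T)
    (h : IsRegression P n T m Y w mhat) :
    ∀ᵐ ω ∂P, mhat ω ∈ T ∧ ‖mhat ω - m‖ ^ 2 ≤ 2 / √(n : ℝ) * ⟪w ω, mhat ω - m⟫ := by
  have hn' : (0 : ℝ) < n := by exact_mod_cast hn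
  filter_upwards [h.erm] with ω hω
  refine ⟨hω.1, sq_norm_le_of_card_mul_le hn ?_⟩
  have h1 : 1 / (n : ℝ) * ‖√(n : ℝ) • mhat ω - Y ω‖ ^ 2 ≤
      1 / (n : ℝ) * ‖√(n : ℝ) • m - Y ω‖ ^ 2 := hω.2 hm
  have h2 := le_of_mul_le_mul_left h1 (by positivity)
  have e1 : √(n : ℝ) • mhat ω - Y ω = √(n : ℝ) • (mhat ω - m) - w ω := by
    rw [h.observation ω, smul_sub]
    abel
  have e2 : √(n : ℝ) • m - Y ω = -w ω := by
    rw [h.observation ω]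
    abel
  rw [e1, e2, norm_neg, norm_sub_sq_real, norm_smul, mul_pow, Real.norm_eq_abs, sq_abs,
    Real.sq_sqrt hn'.le, real_inner_smul_left, real_inner_comm] at h2
  linarith

end BasicInequality

lemma two_mul_div_mul_sqrt {lam x y n : ℝ} (hlam : 0 < lam) (hx : 0 ≤ x) (hy : 0 ≤ y)
    (hn : 0 < n) :
    2 * lam / √n * √(2 * x * (y / lam)) = √(8 * x * lam * y / n) := by
  rw [eq_comm, Real.sqrt_eq_iff_mul_self_eq (by positivity) (by positivity), eq_comm]
  have h1 : √(2 * x * (y / lam)) * √(2 * x * (y / lam)) = 2 * x * (y / lam) :=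
    Real.mul_self_sqrt (by positivity)
  have h2 : √n * √n = n := Real.mul_self_sqrt hn.le
  calc 2 * lam / √n * √(2 * x * (y / lam)) * (2 * lam / √n * √(2 * x * (y / lam)))
      = 4 * lam ^ 2 / (√n * √n) * (√(2 * x * (y / lam)) * √(2 * x * (y / lam))) := by ring
    _ = _ := by
      rw [h1, h2]
      field_simp
      ring

section Tail

variable {H : Type*} [NormedAddCommGroup H] [InnerProductSpace ℝ H] [CompleteSpace H]
  [SecondCountableTopology H] [MeasurableSpace H] [BorelSpace H]
  {Ω : Type*} [MeasurableSpace Ω] {P : Measure Ω} [IsProbabilityMeasure P]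
  {γ : Measure H} {w : Ω → H}

/-- With `Q` the law tilted by `λ ‖z‖²` and `ε = λ E_Q ‖z‖² - ψ` its relative entropy, the bound
holds at every `ε + η`, `η > 0`, up to the error `η`; the slack `η` covers the case `ε = 0`. -/
lemma exists_le_of_sq_norm_le (hγ : LogSobolev γ) (hint : Integrable (fun x => x) γ)
    (hw : HasLaw w γ P) {K S : Set H} (hK : IsCompact K) (hKS : K ⊆ S) {z : Ω → H}
    (hz : Measurable z) (hzK : ∀ᵐ ω ∂P, z ω ∈ K) {n : ℕ} (hn : 0 < n)
    (hzw : ∀ᵐ ω ∂P, ‖z ω‖ ^ 2 ≤ 2 / √(n : ℝ) * ⟪w ω, z ω⟫)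
    {G : ℝ → ℝ} (hG : IsWidthMoment γ S G) {lam ψ : ℝ} (hlam : 0 < lam)
    (hψ : ψ = Real.log (∫ ω, Real.exp (lam * ‖z ω‖ ^ 2) ∂P)) {η : ℝ} (hη : 0 < η) :
    ∃ ε, 0 < ε ∧ ψ - η ≤ -ε + 2 * lam / √(n : ℝ) * G ((ε + ψ) / lam) +
      √(8 * ε * lam * (ε + ψ) / (n : ℝ)) := by
  obtain ⟨R, hR⟩ := hK.isBounded.exists_norm_le
  set f : Ω → ℝ := fun ω => lam * ‖z ω‖ ^ 2 with hf
  have hfm : Measurable f := (hz.norm.pow_const 2).const_mul lam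
  have hf0 : ∀ ω, 0 ≤ f ω := fun ω => by positivity
  have hfb : ∀ᵐ ω ∂P, f ω ≤ lam * R ^ 2 := by
    filter_upwards [hzK] with ω hω
    exact mul_le_mul_of_nonneg_left (pow_le_pow_left₀ (norm_nonneg _) (hR _ hω) 2) hlam.le
  have hfexp : Integrable (fun ω => Real.exp (f ω)) P := by
    refine (integrable_const (Real.exp (lam * R ^ 2))).mono' hfm.exp.aestronglyMeasurable ?_
    filter_upwards [hfb] with ω hω
    rw [Real.norm_eq_abs, Real.abs_exp]
    exact Real.exp_le_exp.2 hω
  have hQp : IsProbabilityMeasure (P.tilted f) := isProbabilityMeasure_tilted hfexp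
  have hac := tilted_absolutelyContinuous P f
  have hfQ : Integrable f (P.tilted f) := by
    refine (integrable_const (lam * R ^ 2)).mono' hfm.aestronglyMeasurable ?_
    filter_upwards [hac.ae_le hfb] with ω hω
    rwa [Real.norm_eq_abs, abs_of_nonneg (hf0 ω)]
  have hwP : Integrable w P := by
    have h1 : Integrable (fun x => x) (P.map w) := by rwa [hw.map_eq]
    exact h1.comp_aemeasurable hw.aemeasurable
  have hwQ : Integrable w (P.tilted f) := by
    rw [integrable_tilted_iff hfexp]
    refine (hwP.norm.const_mul (Real.exp (lam * R ^ 2))).mono'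
      (hfm.exp.aestronglyMeasurable.smul hwP.aestronglyMeasurable) ?_
    filter_upwards [hfb] with ω hω
    rw [norm_smul, Real.norm_eq_abs, Real.abs_exp]
    exact mul_le_mul_of_nonneg_right (Real.exp_le_exp.2 hω) (norm_nonneg _)
  set M := ∫ ω, ‖z ω‖ ^ 2 ∂P.tilted f with hM
  have hfM : ∫ ω, f ω ∂P.tilted f = lam * M := integral_const_mul _ _
  have hM0 : 0 ≤ M := integral_nonneg fun ω => by positivity
  have hε0 : 0 ≤ lam * M - ψ := by
    have := integral_tilted_le hfexp hfQ (integrable_zero Ω ℝ _) (h := fun _ => 0)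
      (integrable_const _)
    rw [hfM, ← hψ] at this
    simpa using this
  set ε := lam * M - ψ + η with hε
  have hεpos : 0 < ε := by linarith
  have hεψ : (ε + ψ) / lam = M + η / lam := by
    rw [hε]
    field_simp
    ring
  set E := (ε + ψ) / lam with hE
  have hEpos : 0 < E := by rw [hεψ]; positivity
  have hME : M ≤ E := by
    rw [hεψ]
    linarith [div_pos hη hlam]
  have hψε : 0 ≤ ε + ψ := by
    have : 0 ≤ lam * M := by positivity
    linarith
  refine ⟨ε, hεpos, ?_⟩
  -- Optimal choice in `ε / s + s E / 2`, which becomes `√(2 ε E)`.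
  set s := √(2 * ε * E) / E with hs
  have hroot : 0 < √(2 * ε * E) := Real.sqrt_pos.2 (by positivity)
  have hspos : 0 < s := div_pos hroot hEpos
  have hsval : ε / s + s * (E / 2) = √(2 * ε * E) := by
    have h1 : √(2 * ε * E) * √(2 * ε * E) = 2 * ε * E := Real.mul_self_sqrt (by positivity)
    rw [hs]
    generalize √(2 * ε * E) = r at h1 hroot
    field_simp
    linarith
  have hmain := integral_inner_tilted_le hγ hint hw hfexp hfQ hwQ hK hz hzK hspos
    (B := G E) fun μ hμ hμK hμi hμle => (hG E hEpos.le).2 μ hμ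
      (hμK.mono fun x hx => hKS hx) hμi (hμle.trans hME)
  rw [hfM, ← hψ, ← hM] at hmain
  have hbound : ∫ ω, ⟪w ω, z ω⟫ ∂P.tilted f ≤ G E + √(2 * ε * E) := by
    have h1 : (lam * M - ψ) / s ≤ ε / s :=
      div_le_div_of_nonneg_right (by linarith) hspos.le
    have h2 : s * (M / 2) ≤ s * (E / 2) := mul_le_mul_of_nonneg_left (by linarith) hspos.le
    linarith
  have hzi : Integrable (fun ω => ‖z ω‖ ^ 2) (P.tilted f) := by
    have := hfQ.const_mul lam⁻¹
    simpa only [hf, inv_mul_cancel_left₀ hlam.ne'] using this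
  have hwi : Integrable (fun ω => ⟪w ω, z ω⟫) (P.tilted f) := by
    refine (hwQ.norm.mul_const R).mono'
      (hwQ.aestronglyMeasurable.inner hz.aestronglyMeasurable) ?_
    filter_upwards [hac.ae_le hzK] with ω hω
    exact (norm_inner_le_norm _ _).trans (mul_le_mul_of_nonneg_left (hR _ hω) (norm_nonneg _))
  have hbasic : M ≤ 2 / √(n : ℝ) * ∫ ω, ⟪w ω, z ω⟫ ∂P.tilted f := by
    rw [← integral_const_mul]
    exact integral_mono_ae hzi (hwi.const_mul _) (hac.ae_le hzw)
  have hn' : (0 : ℝ) < n := by exact_mod_cast hn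
  rw [← two_mul_div_mul_sqrt hlam hεpos.le hψε hn', ← hE]
  have h1 : lam * M ≤ 2 * lam / √(n : ℝ) * (G E + √(2 * ε * E)) := by
    calc lam * M ≤ lam * (2 / √(n : ℝ) * ∫ ω, ⟪w ω, z ω⟫ ∂P.tilted f) :=
          mul_le_mul_of_nonneg_left hbasic hlam.le
      _ = 2 * lam / √(n : ℝ) * ∫ ω, ⟪w ω, z ω⟫ ∂P.tilted f := by ring
      _ ≤ _ := mul_le_mul_of_nonneg_left hbound (by positivity)
  rw [mul_add] at h1
  linarith

end Tail
end ERMTail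
end

theorem theorem4
    {H : Type*} [NormedAddCommGroup H] [InnerProductSpace ℝ H] [CompleteSpace H]
    [SecondCountableTopology H] [MeasurableSpace H] [BorelSpace H]
    {Ω : Type*} [MeasurableSpace Ω] (P : Measure Ω) [IsProbabilityMeasure P]
    (n : ℕ) (hn : 0 < n)
    (T : Set H) (hT_closed : IsClosed T) (hT_tb : TotallyBounded T)
    (m : H) (hm : m ∈ T)
    (w mhat : Ω → H) (hmhat : AEMeasurable mhat P)
    (hERM : (∃ X : Fin n → Ω → H, ERMTail.IsMeanEstimation P n T m X w mhat) ∨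
      (∃ Y : Ω → H, ERMTail.IsRegression P n T m Y w mhat))
    (γ : Measure H) (hw : HasLaw w γ P)
    (hγ_mean : ERMTail.ZeroMean γ) (hγ_lsi : ERMTail.LogSobolev γ)
    (G : ℝ → ℝ) (hG : ERMTail.IsWidthMoment γ (T - T) G)
    (ψ : ℝ → ℝ)
    (hψ : ∀ l, ψ l = Real.log (∫ ω, Real.exp (l * ‖m - mhat ω‖ ^ 2) ∂P))
    (lam : ℝ) (hlam : 0 ≤ lam) :
    Integrable (fun ω => Real.exp (lam * ‖m - mhat ω‖ ^ 2)) P ∧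
    (ψ lam : EReal) ≤ ⨆ (ε : ℝ) (_ : 0 < ε),
      ((-ε + 2 * lam / √(n : ℝ) * G ((ε + ψ lam) / lam)
        + √(8 * ε * lam * (ε + ψ lam) / (n : ℝ)) : ℝ) : EReal) := by
  have hbasic : ∀ᵐ ω ∂P, mhat ω ∈ T ∧
      ‖mhat ω - m‖ ^ 2 ≤ 2 / √(n : ℝ) * ⟪w ω, mhat ω - m⟫ := by
    rcases hERM with ⟨X, hX⟩ | ⟨Y, hY⟩
    · exact hX.sq_norm_sub_le hn hm
    · exact hY.sq_norm_sub_le hn hm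
  have hT : IsCompact T := hT_tb.isCompact_of_isClosed hT_closed
  constructor
  · obtain ⟨R, hR⟩ := (hT.isBounded.sub (Bornology.isBounded_singleton (x := m))).exists_norm_le
    refine (integrable_const (Real.exp (lam * R ^ 2))).mono'
      (((hmhat.const_sub m).norm.pow_const 2).const_mul lam).exp.aestronglyMeasurable ?_
    filter_upwards [hbasic] with ω hω
    rw [Real.norm_eq_abs, Real.abs_exp, Real.exp_le_exp, norm_sub_rev]
    exact mul_le_mul_of_nonneg_left (pow_le_pow_left₀ (norm_nonneg _)
      (hR _ (Set.sub_mem_sub hω.1 rfl)) 2) hlam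
  refine le_of_forall_lt fun c hc => ?_
  obtain ⟨r, hcr, hr⟩ := EReal.lt_iff_exists_real_btwn.1 hc
  refine hcr.trans_le ?_
  have hr' : r < ψ lam := EReal.coe_lt_coe_iff.1 hr
  suffices h : ∃ ε, 0 < ε ∧ r ≤ -ε + 2 * lam / √(n : ℝ) * G ((ε + ψ lam) / lam)
      + √(8 * ε * lam * (ε + ψ lam) / (n : ℝ)) by
    obtain ⟨ε, hε, hle⟩ := h
    exact le_iSup₂_of_le ε hε (EReal.coe_le_coe_iff.2 hle)
  -- For `λ = 0` both `ψ` and the terms other than `-ε` vanish, and `ε` may be taken small.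
  rcases hlam.eq_or_lt with rfl | hlam
  · have h0 : ψ 0 = 0 := by simp [hψ]
    refine ⟨ψ 0 - r, by linarith, ?_⟩
    simp [h0]
  · have hz : (fun ω => mhat ω - m) =ᵐ[P] fun ω => hmhat.mk mhat ω - m := by
      filter_upwards [hmhat.ae_eq_mk] with ω hω
      rw [hω]
    obtain ⟨ε, hε, hle⟩ := ERMTail.exists_le_of_sq_norm_le hγ_lsi hγ_mean.1 hw
      (K := T - {m}) (S := T - T)
      (by simpa only [sub_eq_add_neg, Set.neg_singleton] using hT.add isCompact_singleton)
      (Set.sub_subset_sub_left (Set.singleton_subset_iff.2 hm))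
      (z := fun ω => hmhat.mk mhat ω - m) (hmhat.measurable_mk.sub_const m)
      (by
        filter_upwards [hbasic, hz] with ω hω hzω
        rw [← hzω]
        exact Set.sub_mem_sub hω.1 rfl) hn
      (by
        filter_upwards [hbasic, hz] with ω hω hzω
        rw [← hzω]
        exact hω.2) hG hlam (ψ := ψ lam)
      (by
        rw [hψ]
        congr 1
        refine integral_congr_ae ?_
        filter_upwards [hz] with ω hzω
        rw [← hzω, norm_sub_rev]) (sub_pos.2 hr')
    exact ⟨ε, hε, by linarith⟩
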